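/- All graphs are finite. For a connected plane graph $G$, the degree $\deg_G(f)$ of a face $f$ is the number of vertices incident with $f$. A cyclic coloring of $G$ is a vertex coloring in which any two different vertices incident with a common face receive different colors, and $\chi_c(G)$ is the minimum number of colors in a cyclic coloring of $G$. Let $t(G)$ denote the number of vertices of a longest path of $G$ all of whose vertices have degree $2$ in $G$ (with $t(G)=0$ if there is no vertex of degree $2$). A plane graph $G$ is a subdivision of a plane graph $R$ if it is obtained by replacing the edges of $R$, within its drawing, by paths through new vertices (possibly none); each face $f$ of $G$ then corresponds to a unique face $f'$ of $R$. **Theorem.** If $G$ is a subdivision of a simple $3$-connected plane graph $R$, then $$\chi_c(G) \le \max_{f\in F(G)}\bigl\{\deg_G(f)-\deg_R(f')\bigr\} + t(G) + \chi_c(R),$$ where $F(G)$ is the set of faces of $G$ and $f'$ is the face of $R$ corresponding to the face $f$ of $G$. Moreover, the bound is tight: for every integer $t\ge 0$ there are a simple $3$-connected plane graph $R$ and a subdivision $G$ of $R$ with $t(G)=t$ for which equality holds. -/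

import Mathlib

universe u v

/-- A connected plane graph without loops and multiple edges, given combinatorially by its rotation
system.  The permutation `rot` sends a dart (an edge directed away from one of its ends `v`) to the
next dart, in the cyclic order around `v` in the drawing, that leaves `v`.  The field `euler` says
that the surface obtained by gluing a disc to every facial walk is the sphere.  (The graph with a
single vertex and no edge has no darts; it is not covered.) -/
structure PlaneGraph (V : Type u) where
  /-- the underlying abstract graph -/
  graph : SimpleGraph V
  /-- the cyclic orders of the edges around the vertices -/
  rot : Equiv.Perm graph.Dart
  rot_fst : ∀ d, (rot d).fst = d.fst
  rot_cyclic : ∀ d e : graph.Dart, d.fst = e.fst → rot.SameCycle d e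
  connected : graph.Connected
  /-- Euler's formula, the number of faces being the number of orbits of the map that sends a dart
  to the next dart of the facial walk through it -/
  euler : (Nat.card V : ℤ) - Nat.card graph.edgeSet
    + Nat.card (Quotient (Equiv.Perm.SameCycle.setoid
        ((SimpleGraph.Dart.symm_involutive (G := graph)).toPerm.trans rot))) = 2

namespace PlaneGraph

variable {V : Type u} (G : PlaneGraph V)

/-- The successor of a dart in its facial walk: having traversed the dart from `v` to `w`,
continue with the dart that follows the reversed dart in the rotation at `w`. -/
def facePerm : Equiv.Perm G.graph.Dart :=
  (SimpleGraph.Dart.symm_involutive (G := G.graph)).toPerm.trans G.rot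

/-- The faces: the cyclic facial walks. -/
def Face : Type u := Quotient (Equiv.Perm.SameCycle.setoid G.facePerm)

/-- The face whose facial walk contains the dart `d`. -/
def faceOf (d : G.graph.Dart) : G.Face :=
  Quotient.mk (Equiv.Perm.SameCycle.setoid G.facePerm) d

variable {G} in
/-- The vertex `w` is incident with the face `f`. -/
def Incident (w : V) (f : G.Face) : Prop :=
  ∃ d : G.graph.Dart, d.fst = w ∧ G.faceOf d = f

/-- The degree of a face: the number of vertices incident with it. -/
noncomputable def faceDegree (f : G.Face) : ℕ :=
  {w : V | Incident w f}.ncard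

/-- A cyclic coloring: distinct vertices that are incident with a common face get distinct
colors. -/
def IsCyclicColoring {C : Type*} (c : V → C) : Prop :=
  ∀ (f : G.Face) (x y : V), Incident x f → Incident y f → x ≠ y → c x ≠ c y

/-- The cyclic chromatic number (of a finite plane graph). -/
noncomputable def cyclicChromaticNumber : ℕ :=
  sInf {k : ℕ | ∃ c : V → Fin k, G.IsCyclicColoring c}

/-- The number of vertices of a longest path all vertices of which have degree 2
(of a finite plane graph; it is `0` if there is no vertex of degree 2). -/
noncomputable def longestTwoPath : ℕ :=
  sSup {n : ℕ | ∃ (x y : V) (p : G.graph.Walk x y), p.IsPath ∧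
    (∀ w ∈ p.support, (G.graph.neighborSet w).ncard = 2) ∧ p.support.length = n}

/-- 3-connected: more than three vertices, and no set of fewer than three vertices separates. -/
def IsThreeConnected : Prop :=
  3 < Nat.card V ∧ ∀ S : Set V, S.ncard < 3 → (G.graph.induce Sᶜ).Connected

end PlaneGraph

/-- A presentation of the plane graph `G` as a subdivision of the plane graph `R`: every edge of `R`
is replaced by a path through new vertices, and the drawing is kept. -/
structure PlaneSubdivision {V : Type u} {W : Type v} (R : PlaneGraph V) (G : PlaneGraph W) where
  /-- the vertex of `G` that a vertex of `R` becomes -/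
  branch : V ↪ W
  /-- the path of `G` that replaces an edge of `R`, in either direction -/
  path : ∀ d : R.graph.Dart, G.graph.Walk (branch d.fst) (branch d.snd)
  path_isPath : ∀ d, (path d).IsPath
  path_symm : ∀ d, path d.symm = (path d).reverse
  /-- the inner vertices of the paths are new -/
  branch_mem_path : ∀ d x, branch x ∈ (path d).support → x = d.fst ∨ x = d.snd
  /-- paths that replace different edges have no inner vertex in common -/
  path_disjoint : ∀ d e w, w ∈ (path d).support → w ∈ (path e).support →
    d.edge ≠ e.edge → w ∈ Set.range branch
  vertex_covered : ∀ w, w ∈ Set.range branch ∨ ∃ d, w ∈ (path d).support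
  edge_covered : ∀ e ∈ G.graph.edgeSet, ∃ d, e ∈ (path d).edges
  /-- around the old vertices, the paths leave in the order of the edges that they replace -/
  rot_firstDart : ∀ d (h : ¬ (path d).Nil) (h' : ¬ (path (R.rot d)).Nil),
    G.rot ((path d).firstDart h) = (path (R.rot d)).firstDart h'

namespace PlaneSubdivision

variable {V : Type u} {W : Type v} {R : PlaneGraph V} {G : PlaneGraph W}

/-- The face `f'` of `R` corresponds to the face `f` of `G`: some edge is traversed by the facial
walk of `f'` such that the facial walk of `f` traverses a part of the path that replaces it, in the
same direction. -/
def Corresponds (S : PlaneSubdivision R G) (f : G.Face) (f' : R.Face) : Prop :=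
  ∃ d g, g ∈ (S.path d).darts ∧ R.faceOf d = f' ∧ G.faceOf g = f

theorem mem_path_symm (S : PlaneSubdivision R G) {g : G.graph.Dart} {d : R.graph.Dart} :
    g ∈ (S.path d.symm).darts ↔ g.symm ∈ (S.path d).darts := by
  have h : (S.path d.symm).darts = (S.path d).reverse.darts :=
    congrArg (fun p => SimpleGraph.Walk.darts p) (S.path_symm d)
  rw [h, SimpleGraph.Walk.mem_darts_reverse]

theorem exists_path (S : PlaneSubdivision R G) (g : G.graph.Dart) :
    ∃ d, g ∈ (S.path d).darts := by
  obtain ⟨d, hd⟩ := S.edge_covered g.edge g.edge_mem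
  obtain ⟨h, hh, he⟩ := List.mem_map.1 hd
  rcases (SimpleGraph.dart_edge_eq_iff _ _).1 he with rfl | rfl
  · exact ⟨d, hh⟩
  · refine ⟨d.symm, ?_⟩
    rwa [S.mem_path_symm]

theorem not_symm_mem {S : PlaneSubdivision R G} {g : G.graph.Dart} {d : R.graph.Dart}
    (h : g ∈ (S.path d).darts) : g.symm ∉ (S.path d).darts := by
  intro h'
  have hn := (S.path_isPath d).isTrail.edges_nodup
  have := List.inj_on_of_nodup_map hn h h' (by simp)
  exact g.symm_ne this.symm

theorem path_unique (S : PlaneSubdivision R G) {g : G.graph.Dart} {d e : R.graph.Dart}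
    (hd : g ∈ (S.path d).darts) (he : g ∈ (S.path e).darts) : d = e := by
  have h1 := SimpleGraph.Walk.dart_fst_mem_support_of_mem_darts _ hd
  have h2 := SimpleGraph.Walk.dart_snd_mem_support_of_mem_darts _ hd
  have h3 := SimpleGraph.Walk.dart_fst_mem_support_of_mem_darts _ he
  have h4 := SimpleGraph.Walk.dart_snd_mem_support_of_mem_darts _ he
  by_cases hE : d.edge = e.edge
  · rcases (SimpleGraph.dart_edge_eq_iff _ _).1 hE with h | h
    · exact h
    · subst h
      rw [S.mem_path_symm] at hd
      exact absurd hd (not_symm_mem he)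
  · exfalso
    obtain ⟨x, hx⟩ := S.path_disjoint d e _ h1 h3 hE
    obtain ⟨y, hy⟩ := S.path_disjoint d e _ h2 h4 hE
    have hxy : x ≠ y := fun h => g.fst_ne_snd (by rw [← hx, ← hy, h])
    rw [← hx] at h1 h3
    rw [← hy] at h2 h4
    apply hE
    have a1 := S.branch_mem_path _ _ h1
    have a2 := S.branch_mem_path _ _ h2
    have a3 := S.branch_mem_path _ _ h3
    have a4 := S.branch_mem_path _ _ h4
    simp only [SimpleGraph.Dart.edge, Sym2.eq_iff]
    grind

theorem not_nil (S : PlaneSubdivision R G) (d : R.graph.Dart) : ¬ (S.path d).Nil :=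
  SimpleGraph.Walk.not_nil_of_ne fun h => d.fst_ne_snd (S.branch.injective h)

theorem facePerm_mem (S : PlaneSubdivision R G) {g : G.graph.Dart} {d : R.graph.Dart}
    (hg : g ∈ (S.path d).darts) :
    G.facePerm g ∈ (S.path d).darts ∨ G.facePerm g ∈ (S.path (R.facePerm d)).darts := by
  have hp := S.path_isPath d
  obtain ⟨i, hi, rfl⟩ := List.getElem_of_mem hg
  have hi' : i < (S.path d).length := by simpa using hi
  by_cases hl : i + 1 = (S.path d).length
  · right
    have h1 : ((S.path d).darts[i]).symm = (S.path d.symm).firstDart (S.not_nil _) := by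
      have hlast : (S.path d).darts[i] = (S.path d).lastDart (S.not_nil _) := by
        rw [SimpleGraph.Walk.lastDart_eq (S.not_nil _) (by omega)]
        congr 1
        simp only [SimpleGraph.Walk.length_darts]
        omega
      rw [hlast]
      apply SimpleGraph.Dart.ext
      apply Prod.ext
      · rfl
      · have : (S.path d.symm).snd = (S.path d).penultimate := by
          rw [S.path_symm]
          exact SimpleGraph.Walk.snd_reverse _
        exact this.symm
    have h2 : G.facePerm ((S.path d).darts[i]) = G.rot ((S.path d).darts[i]).symm := rfl
    have h3 : R.facePerm d = R.rot d.symm := rfl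
    rw [h2, h1, S.rot_firstDart _ _ (S.not_nil _), h3,
      ← SimpleGraph.Walk.head_darts_eq_firstDart
        (SimpleGraph.Walk.darts_eq_nil.not.2 (S.not_nil _))]
    exact List.head_mem _
  · left
    have key : ∀ j (hj : j < (S.path d).darts.length),
        (S.path d).darts[j].fst = (S.path d).getVert j ∧
        (S.path d).darts[j].snd = (S.path d).getVert (j + 1) := by
      intro j hj
      simp [SimpleGraph.Walk.darts_getElem_eq_getVert]
    have inj : ∀ a b, a ≤ (S.path d).length → b ≤ (S.path d).length →
        (S.path d).getVert a = (S.path d).getVert b → a = b :=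
      fun a b ha hb h => hp.getVert_injOn ha hb h
    set g := (S.path d).darts[i] with hgdef
    set h := G.rot g.symm with hh
    have hfst : h.fst = (S.path d).getVert (i + 1) := by
      rw [hh, G.rot_fst]; exact (key i hi).2
    have hnb : (S.path d).getVert (i + 1) ∉ Set.range S.branch := by
      rintro ⟨x, hx⟩
      have := S.branch_mem_path d x (hx ▸ SimpleGraph.Walk.getVert_mem_support _ _)
      rcases this with rfl | rfl
      · have := inj (i + 1) 0 (by omega) (by omega) (by rw [← hx]; simp)
        omega
      · have := inj (i + 1) (S.path d).length (by omega) le_rfl (by rw [← hx]; simp)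
        omega
    have hcases : h ∈ (S.path d).darts ∨ h.symm ∈ (S.path d).darts := by
      obtain ⟨e, he⟩ := S.exists_path h
      have hE : d.edge = e.edge := by
        by_contra hE
        refine hnb (S.path_disjoint d e _ (SimpleGraph.Walk.getVert_mem_support _ _) ?_ hE)
        rw [← hfst]
        exact SimpleGraph.Walk.dart_fst_mem_support_of_mem_darts _ he
      rcases (SimpleGraph.dart_edge_eq_iff _ _).1 hE with rfl | rfl
      · exact Or.inl he
      · right
        rw [S.mem_path_symm]
        simpa using he
    rcases hcases with hc | hc
    · exact hc
    · exfalso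
      obtain ⟨j, hj, hjh⟩ := List.getElem_of_mem hc
      have hj' : j < (S.path d).length := by simpa using hj
      have e1 := (key j hj).2
      rw [hjh] at e1
      have e2 : (S.path d).getVert (i + 1) = (S.path d).getVert (j + 1) := by
        rw [← hfst, ← e1]; rfl
      have e3 := inj _ _ (by omega) (by omega) e2
      obtain rfl : i = j := by omega
      have hfix : G.rot g.symm = g.symm := by
        rw [← hh, hgdef, hjh, SimpleGraph.Dart.symm_symm]
      have hi2 : i + 1 < (S.path d).darts.length := by
        rw [SimpleGraph.Walk.length_darts]; omega
      have hs : G.rot.SameCycle g.symm (S.path d).darts[i + 1] :=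
        G.rot_cyclic _ _ (by rw [(key (i + 1) hi2).1, ← (key i hi).2]; rfl)
      have heq : g.symm = (S.path d).darts[i + 1] := by
        obtain ⟨n, hn⟩ := hs
        rw [← hn]
        exact (Function.IsFixedPt.perm_zpow hfix n).symm
      have e4 := (key (i + 1) hi2).2
      rw [← heq] at e4
      have e5 : (S.path d).getVert i = (S.path d).getVert (i + 1 + 1) := by
        rw [← e4, ← (key i hi).1]; rfl
      have := inj _ _ (by omega) (by omega) e5
      omega

/-- Every face of the subdivision corresponds to exactly one face of the original graph. -/
theorem existsUnique_corresponds (S : PlaneSubdivision R G) (f : G.Face) :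
    ∃! f', S.Corresponds f f' := by
  choose ρ hρ using S.exists_path
  have step : ∀ g, R.faceOf (ρ (G.facePerm g)) = R.faceOf (ρ g) := by
    intro g
    rcases S.facePerm_mem (hρ g) with h | h
    · rw [S.path_unique (hρ _) h]
    · rw [S.path_unique (hρ _) h]
      exact Quotient.sound ((Equiv.Perm.SameCycle.refl _ _).apply_left)
  have pow : ∀ (n : ℤ) g, R.faceOf (ρ ((G.facePerm ^ n) g)) = R.faceOf (ρ g) := by
    intro n
    induction n with
    | zero => intro g; rfl
    | succ n ih => intro g; rw [zpow_add_one, Equiv.Perm.mul_apply, ih, step]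
    | pred n ih =>
      intro g
      rw [zpow_sub_one, Equiv.Perm.mul_apply, ih, ← step (G.facePerm⁻¹ g)]
      congr 2
      exact G.facePerm.apply_symm_apply g
  obtain ⟨g, rfl⟩ : ∃ g, G.faceOf g = f := Quotient.exists_rep f
  refine ⟨R.faceOf (ρ g), ⟨_, g, hρ g, rfl, rfl⟩, ?_⟩
  rintro _ ⟨d, g', hg', rfl, hf⟩
  obtain ⟨n, hn⟩ : G.facePerm.SameCycle g g' := Quotient.exact hf.symm
  rw [S.path_unique hg' (hρ g'), ← hn, pow]

/-- The face of the original graph that corresponds to a face of the subdivision. -/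
noncomputable def origFace (S : PlaneSubdivision R G) (f : G.Face) : R.Face :=
  (S.existsUnique_corresponds f).choose

/-- The maximum of `deg_G f - deg_R f'` over the (finitely many) faces `f` of `G`, where `f'` is the
face of `R` that corresponds to `f`. -/
noncomputable def maxExcess (S : PlaneSubdivision R G) : ℤ :=
  ⨆ f : G.Face, ((G.faceDegree f : ℤ) - R.faceDegree (S.origFace f))

end PlaneSubdivision

/-!
Color the old vertices by a cyclic coloring of `R`. Consider a new vertex, inside the path that
replaces an edge `e` of `R`, as an edge of a multigraph on the faces that joins the two faces on the
sides of `e`: new vertices incident with a common face then correspond to edges with a common end.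
The degree of a face in this multigraph is at most the maximal excess `Δ`, and an edge has
multiplicity at most `t(G)` because the dual of `R` has no multiple edges: two edges of `R` with the
same faces on their sides would be an edge cut, since by Euler's formula the cycles of the dual are
exactly the cuts of `R` (over `ZMod 2`). Vizing's theorem for multigraphs colors the new vertices
with `Δ + t(G)` further colors.

For the tightness, subdivide each of three edges of `K₄` with a common end `t` times. Any two
vertices of the resulting graph are incident with a common face, so all `3 * t + 4` vertices need
different colors, while the maximal excess is at most `2 * t`.
-/

/-! ### Vizing's theorem for multigraphs -/

section MaxDegreeTwo

variable {X : Type*} [Fintype X] {H : SimpleGraph X} [DecidableRel H.Adj]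

theorem card_degree_le_one_le_two (hH : H.Connected) (h2 : ∀ v, H.degree v ≤ 2) :
    (Finset.univ.filter fun v => H.degree v ≤ 1).card ≤ 2 := by
  classical
  have hbound : ∀ v ∈ Finset.univ, H.degree v + (if H.degree v ≤ 1 then 1 else 0) ≤ 2 := by
    intro v _
    have := h2 v
    split_ifs <;> omega
  have hsum := Finset.sum_le_sum hbound
  rw [Finset.sum_add_distrib, H.sum_degrees_eq_twice_card_edges, ← Finset.card_filter,
    Finset.sum_const, Finset.card_univ, smul_eq_mul] at hsum
  have htree := hH.card_vert_le_card_edgeSet_add_one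
  rw [Nat.card_eq_fintype_card, Nat.card_eq_fintype_card, ← SimpleGraph.edgeFinset_card] at htree
  omega

theorem card_reachable_degree_le_one_le_two (h2 : ∀ v, H.degree v ≤ 2) {T : Finset X} {x : X}
    (hreach : ∀ v ∈ T, H.Reachable v x) (hT : ∀ v ∈ T, H.degree v ≤ 1) : T.card ≤ 2 := by
  classical
  set K := H.connectedComponentMk x
  let φ : SimpleGraph.Copy K.toSimpleGraph H := (SimpleGraph.Embedding.induce K.supp).toCopy
  have hdeg : ∀ v : K, K.toSimpleGraph.degree v ≤ H.degree v.1 := fun v => φ.degree_le v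
  refine (Finset.card_le_card_of_surjOn Subtype.val fun v hv => ?_).trans
    (card_degree_le_one_le_two K.connected_toSimpleGraph fun v => (hdeg v).trans (h2 v))
  have hvK : v ∈ K.supp := SimpleGraph.ConnectedComponent.sound (hreach v hv)
  exact ⟨⟨v, hvK⟩, by simpa using (hdeg ⟨v, hvK⟩).trans (hT v hv), rfl⟩

end MaxDegreeTwo

namespace EdgeColoring

variable {E X C : Type*}

/-- The coloring `c` of the edges of a multigraph is proper on the set `D` of edges: edges of `D`
with a common end get distinct colors. The multigraph is given by the ends of its edges. -/
def Proper (ends : E → Sym2 X) (D : Finset E) (c : E → C) : Prop :=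
  ∀ e ∈ D, ∀ e' ∈ D, e ≠ e' → ∀ v, v ∈ ends e → v ∈ ends e' → c e ≠ c e'

/-- The color `a` is missing at the vertex `v`: no edge of `D` at `v` has this color. -/
def Missing (ends : E → Sym2 X) (D : Finset E) (c : E → C) (v : X) (a : C) : Prop :=
  ∀ e ∈ D, v ∈ ends e → c e ≠ a

/-- The fans of Vizing's theorem: the edges `s 0, …, s n` join `x` to `y 0, …, y n`, the first one
is `e₀`, and the color of each of the others is missing at the far end of the previous one.
Repetitions are allowed. -/
structure IsFan (ends : E → Sym2 X) (D : Finset E) (c : E → C) (x : X) (e₀ : E) (n : ℕ)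
    (s : ℕ → E) (y : ℕ → X) : Prop where
  zero : s 0 = e₀
  ends_eq : ∀ i ≤ n, ends (s i) = s(x, y i)
  mem : ∀ i < n, s (i + 1) ∈ D
  missing : ∀ i < n, Missing ends D c (y i) (c (s (i + 1)))

variable {ends : E → Sym2 X} {D : Finset E} {c : E → C} {x : X} {e₀ : E} {n : ℕ} {s : ℕ → E}
  {y : ℕ → X}

section Update

variable [DecidableEq E] {f : E} {a b : C} {v : X}

theorem Proper.missing_erase (hc : Proper ends D c) (hf : f ∈ D) (hv : v ∈ ends f) :
    Missing ends (D.erase f) c v (c f) := fun e he hve =>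
  hc e (Finset.mem_of_mem_erase he) f hf (Finset.ne_of_mem_erase he) v hve hv

theorem Missing.erase (h : Missing ends D c v a) : Missing ends (D.erase f) c v a :=
  fun e he => h e (Finset.mem_of_mem_erase he)

theorem Missing.update (h : Missing ends (D.erase f) c v b) (hab : a ≠ b) :
    Missing ends D (Function.update c f a) v b := by
  intro e he hve
  rcases eq_or_ne e f with rfl | hef
  · rwa [Function.update_self]
  · rw [Function.update_of_ne hef]
    exact h e (Finset.mem_erase.2 ⟨hef, he⟩) hve

theorem Proper.update (hc : Proper ends D c)
    (ha : ∀ v ∈ ends f, Missing ends (D.erase f) c v a) :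
    Proper ends (insert f D) (Function.update c f a) := by
  intro e he e' he' hne v hv hv'
  rcases eq_or_ne e f with rfl | hef
  · have hD : e' ∈ D.erase e :=
      Finset.mem_erase.2 ⟨hne.symm, Finset.mem_of_mem_insert_of_ne he' hne.symm⟩
    rw [Function.update_self, Function.update_of_ne hne.symm]
    exact (ha v hv e' hD hv').symm
  have hD := Finset.mem_of_mem_insert_of_ne he hef
  rw [Function.update_of_ne hef]
  rcases eq_or_ne e' f with rfl | hef'
  · rw [Function.update_self]
    exact ha v hv' e (Finset.mem_erase.2 ⟨hef, hD⟩) hv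
  · rw [Function.update_of_ne hef']
    exact hc e hD e' (Finset.mem_of_mem_insert_of_ne he' hef') hne v hv hv'

end Update

namespace IsFan

theorem mono {m : ℕ} (h : IsFan ends D c x e₀ n s y) (hm : m ≤ n) : IsFan ends D c x e₀ m s y :=
  ⟨h.zero, fun i hi => h.ends_eq i (hi.trans hm), fun i hi => h.mem i (hi.trans_le hm),
    fun i hi => h.missing i (hi.trans_le hm)⟩

theorem center_mem_ends (h : IsFan ends D c x e₀ n s y) {i : ℕ} (hi : i ≤ n) : x ∈ ends (s i) :=
  h.ends_eq i hi ▸ Sym2.mem_mk_left _ _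

theorem end_eq_of_edge_eq (h : IsFan ends D c x e₀ n s y) {i j : ℕ} (hi : i ≤ n) (hj : j ≤ n)
    (hij : s i = s j) : y i = y j :=
  Sym2.congr_right.1 (by rw [← h.ends_eq i hi, ← h.ends_eq j hj, hij])

theorem update [DecidableEq E] {f : E} {a : C} (h : IsFan ends D c x e₀ n s y)
    (hf : ∀ i < n, s (i + 1) ≠ f) (ha : Missing ends D c x a) :
    IsFan ends D (Function.update c f a) x e₀ n s y := by
  refine ⟨h.zero, h.ends_eq, h.mem, fun i hi => ?_⟩
  rw [Function.update_of_ne (hf i hi)]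
  exact (h.missing i hi).erase.update (ha _ (h.mem i hi) (h.center_mem_ends hi)).symm

/-- Recoloring the last edge of the fan with the color missing at both of its ends makes its old
color missing at both ends of the previous edge, so that the colors shift along the fan. -/
theorem exists_proper_insert [DecidableEq E] {a : C} (hc : Proper ends D c)
    (h : IsFan ends D c x e₀ n s y) (hx : Missing ends D c x a) (hy : Missing ends D c (y n) a) :
    ∃ c' : E → C, Proper ends (insert e₀ D) c' := by
  induction n using Nat.strong_induction_on generalizing c a with
  | _ n ih =>
  have hlast : ∀ v ∈ ends (s n), Missing ends (D.erase (s n)) c v a := by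
    intro v hv
    rw [h.ends_eq n le_rfl, Sym2.mem_iff] at hv
    rcases hv with rfl | rfl
    exacts [hx.erase, hy.erase]
  rcases n with _ | m
  · exact ⟨_, h.zero ▸ hc.update hlast⟩
  by_cases hrepeat : ∃ i ≤ m, s i = s (m + 1)
  · obtain ⟨i, hi, his⟩ := hrepeat
    have hyi := h.end_eq_of_edge_eq (hi.trans m.le_succ) le_rfl his
    exact ih i (Nat.lt_succ_of_le hi) hc (h.mono (hi.trans m.le_succ)) hx (hyi ▸ hy)
  push Not at hrepeat
  have hmem := h.mem m m.lt_succ_self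
  have hx_last := h.center_mem_ends (le_refl (m + 1))
  have hne : a ≠ c (s (m + 1)) := (hx _ hmem hx_last).symm
  refine ih m m.lt_succ_self (Finset.insert_eq_self.2 hmem ▸ hc.update hlast)
    ((h.mono m.le_succ).update (fun i hi => hrepeat (i + 1) hi) hx)
    ((hc.missing_erase hmem hx_last).update hne)
    ((h.missing m m.lt_succ_self).erase.update hne)

end IsFan

section Kempe

/-- The graph of the Kempe chains of the colors `a` and `b`: two vertices are adjacent if an edge
of `D` of one of these colors joins them. -/
def kempeGraph (ends : E → Sym2 X) (D : Finset E) (c : E → C) (a b : C) : SimpleGraph X where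
  Adj v w := v ≠ w ∧ ∃ e ∈ D, ends e = s(v, w) ∧ (c e = a ∨ c e = b)
  symm := ⟨fun _ _ ⟨h, e, he, h1, h2⟩ => ⟨h.symm, e, he, h1.trans Sym2.eq_swap, h2⟩⟩
  loopless := ⟨fun _ h => h.1 rfl⟩

open Classical in
/-- The coloring in which the colors `a` and `b` are interchanged on the edges that meet `K`; it is
of use for a union `K` of Kempe chains. -/
noncomputable def kempeSwap (ends : E → Sym2 X) (c : E → C) (a b : C) (K : Set X) (e : E) : C :=
  if ∃ v ∈ K, v ∈ ends e then Equiv.swap a b (c e) else c e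

variable {a b d : C} {K : Set X} {v : X} {e : E}

open Classical in
theorem kempeSwap_of_mem (hv : v ∈ K) (hve : v ∈ ends e) :
    kempeSwap ends c a b K e = Equiv.swap a b (c e) :=
  if_pos ⟨v, hv, hve⟩

theorem kempeSwap_of_notMem (hK : ∀ v w, (kempeGraph ends D c a b).Adj v w → v ∈ K → w ∈ K)
    (he : e ∈ D) (hv : v ∉ K) (hve : v ∈ ends e) : kempeSwap ends c a b K e = c e := by
  classical
  refine ite_eq_right_iff.2 ?_
  rintro ⟨w, hw, hwe⟩
  have hne : w ≠ v := fun h => hv (h ▸ hw)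
  have hends : ends e = s(w, v) := (Sym2.mem_and_mem_iff hne).1 ⟨hwe, hve⟩
  have hab : ¬ (c e = a ∨ c e = b) := fun hab => hv (hK w v ⟨hne, e, he, hends, hab⟩ hw)
  exact Equiv.swap_apply_of_ne_of_ne (fun h => hab (.inl h)) fun h => hab (.inr h)

theorem Proper.kempeSwap (hc : Proper ends D c)
    (hK : ∀ v w, (kempeGraph ends D c a b).Adj v w → v ∈ K → w ∈ K) :
    Proper ends D (kempeSwap ends c a b K) := by
  classical
  intro e he e' he' hne v hv hv'
  by_cases h : v ∈ K
  · rw [kempeSwap_of_mem h hv, kempeSwap_of_mem h hv']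
    exact (Equiv.swap a b).injective.ne (hc e he e' he' hne v hv hv')
  · rw [kempeSwap_of_notMem hK he h hv, kempeSwap_of_notMem hK he' h hv']
    exact hc e he e' he' hne v hv hv'

open Classical in
theorem Missing.kempeSwap_of_mem (hv : v ∈ K)
    (h : Missing ends D c v (Equiv.swap a b d)) :
    Missing ends D (kempeSwap ends c a b K) v d := by
  intro e he hve
  rw [EdgeColoring.kempeSwap_of_mem hv hve, Ne, Equiv.swap_apply_eq_iff]
  exact h e he hve

theorem Missing.kempeSwap_of_notMem
    (hK : ∀ v w, (kempeGraph ends D c a b).Adj v w → v ∈ K → w ∈ K) (hv : v ∉ K)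
    (h : Missing ends D c v d) : Missing ends D (EdgeColoring.kempeSwap ends c a b K) v d := by
  intro e he hve
  rw [EdgeColoring.kempeSwap_of_notMem hK he hv hve]
  exact h e he hve

/-- Otherwise interchanging the two colors on the Kempe chain of `y n` would keep the fan (by
induction the chains starting at earlier ends avoid it) and make `b` missing at both `x` and
`y n`. -/
theorem IsFan.reachable [DecidableEq E]
    (hno : ¬ ∃ c' : E → C, Proper ends (insert e₀ D) c') (hc : Proper ends D c)
    (hx : Missing ends D c x b) (h : IsFan ends D c x e₀ n s y) (hy : Missing ends D c (y n) a) :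
    (kempeGraph ends D c a b).Reachable (y n) x := by
  classical
  induction n using Nat.strong_induction_on with
  | _ n ih =>
  by_contra hr
  set K : Set X := {v | (kempeGraph ends D c a b).Reachable (y n) v}
  have hK : ∀ v w, (kempeGraph ends D c a b).Adj v w → v ∈ K → w ∈ K :=
    fun _ _ hvw hv => SimpleGraph.Reachable.trans hv hvw.reachable
  have hxK : x ∉ K := hr
  have hyK : y n ∈ K := SimpleGraph.Reachable.refl _
  have hswap : IsFan ends D (kempeSwap ends c a b K) x e₀ n s y := by
    refine ⟨h.zero, h.ends_eq, h.mem, fun i hi => ?_⟩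
    have hxi := h.center_mem_ends (Nat.succ_le_of_lt hi)
    have hm := h.missing i hi
    rw [kempeSwap_of_notMem hK (h.mem i hi) hxK hxi]
    by_cases hyi : y i ∈ K
    · have hb : c (s (i + 1)) ≠ b := hx _ (h.mem i hi) hxi
      have ha : c (s (i + 1)) ≠ a := fun ha =>
        hxK (SimpleGraph.Reachable.trans hyi (ih i hi (h.mono hi.le) (ha ▸ hm)))
      exact Missing.kempeSwap_of_mem hyi (by rwa [Equiv.swap_apply_of_ne_of_ne ha hb])
    · exact hm.kempeSwap_of_notMem hK hyi
  exact hno (hswap.exists_proper_insert (hc.kempeSwap hK) (hx.kempeSwap_of_notMem hK hxK)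
    (Missing.kempeSwap_of_mem hyK (by rwa [Equiv.swap_apply_right])))

open Classical in
theorem degree_kempeGraph_le [Fintype X] (hc : Proper ends D c) (a b : C) (v : X) :
    (kempeGraph ends D c a b).degree v ≤
      (({a, b} : Finset C).filter fun d => ¬ Missing ends D c v d).card := by
  rw [← SimpleGraph.card_neighborFinset_eq_degree]
  refine Finset.card_le_card_of_forall_subsingleton
    (fun w d => ∃ e ∈ D, ends e = s(v, w) ∧ c e = d) (fun w hw => ?_) ?_
  · obtain ⟨_, e, he, hends, hcol⟩ := (SimpleGraph.mem_neighborFinset _ _ _).1 hw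
    have hv : v ∈ ends e := hends ▸ Sym2.mem_mk_left v w
    exact ⟨c e, Finset.mem_filter.2 ⟨by simpa using hcol, fun h => h e he hv rfl⟩,
      e, he, hends, rfl⟩
  · rintro d - w ⟨-, e, he, hends, hcol⟩ w' ⟨-, e', he', hends', hcol'⟩
    have hee : e = e' := by
      by_contra hne
      exact hc e he e' he' hne v (hends ▸ Sym2.mem_mk_left v w)
        (hends' ▸ Sym2.mem_mk_left v w') (hcol.trans hcol'.symm)
    exact Sym2.congr_right.1 (by rw [← hends, hee, hends'])

open Classical in
theorem degree_kempeGraph_le_two [Fintype X] (hc : Proper ends D c) (a b : C) (v : X) :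
    (kempeGraph ends D c a b).degree v ≤ 2 :=
  (degree_kempeGraph_le hc a b v).trans ((Finset.card_filter_le _ _).trans Finset.card_le_two)

open Classical in
theorem degree_kempeGraph_le_one [Fintype X] (hc : Proper ends D c)
    (hd : d = a ∨ d = b) (hv : Missing ends D c v d) :
    (kempeGraph ends D c a b).degree v ≤ 1 := by
  have hlt : (({a, b} : Finset C).filter fun d => ¬ Missing ends D c v d).card <
      ({a, b} : Finset C).card :=
    Finset.card_lt_card (Finset.filter_ssubset.2 ⟨d, by simpa using hd, not_not.2 hv⟩)
  have := degree_kempeGraph_le hc a b v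
  have := Finset.card_le_two (a := a) (b := b)
  omega

end Kempe

section FanEdge

/-- The edge `f` is the last edge of a fan at `x` that starts with `e₀`, and `z` is its far end. -/
def IsFanEdge (ends : E → Sym2 X) (D : Finset E) (c : E → C) (x : X) (e₀ f : E) (z : X) : Prop :=
  ∃ n s y, IsFan ends D c x e₀ n s y ∧ s n = f ∧ y n = z

variable {f g : E} {z w : X} {a b : C}

theorem isFanEdge_start (h : ends e₀ = s(x, z)) : IsFanEdge ends D c x e₀ e₀ z :=
  ⟨0, fun _ => e₀, fun _ => z, ⟨rfl, fun _ _ => h, nofun, nofun⟩, rfl, rfl⟩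

namespace IsFanEdge

theorem ends_eq (h : IsFanEdge ends D c x e₀ f z) : ends f = s(x, z) := by
  obtain ⟨n, s, y, h, rfl, rfl⟩ := h
  exact h.ends_eq n le_rfl

theorem step (h : IsFanEdge ends D c x e₀ f z) (hg : g ∈ D) (hx : x ∈ ends g)
    (hz : Missing ends D c z (c g)) : ∃ w, IsFanEdge ends D c x e₀ g w := by
  obtain ⟨n, s, y, h, rfl, rfl⟩ := h
  obtain ⟨w, hw⟩ := Sym2.mem_iff_exists.1 hx
  refine ⟨w, n + 1, fun i => if i ≤ n then s i else g, fun i => if i ≤ n then y i else w,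
    ⟨by simpa using h.zero, fun i _ => ?_, fun i _ => ?_, fun i hi => ?_⟩, by simp, by simp⟩
  · split_ifs with hin
    exacts [h.ends_eq i hin, hw]
  · split_ifs with hin
    exacts [h.mem i hin, hg]
  · rw [if_pos (Nat.le_of_lt_succ hi)]
    split_ifs with hin
    · exact h.missing i hin
    · obtain rfl : i = n := by omega
      exact hz

theorem not_missing_center [DecidableEq E] (h : IsFanEdge ends D c x e₀ f z)
    (hc : Proper ends D c) (hno : ¬ ∃ c' : E → C, Proper ends (insert e₀ D) c')
    (hz : Missing ends D c z a) : ¬ Missing ends D c x a := by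
  obtain ⟨n, s, y, h, rfl, rfl⟩ := h
  exact fun hx => hno (h.exists_proper_insert hc hx hz)

theorem center_ne_end (h : IsFanEdge ends D c x e₀ f z) (hloop : ∀ e, ¬ (ends e).IsDiag) :
    x ≠ z := by
  rintro rfl
  exact hloop f (by rw [h.ends_eq]; exact Sym2.mk_isDiag_iff.2 rfl)

/-- Otherwise the Kempe component of the center would contain three vertices of degree at most one,
but its vertices have degree at most two. -/
theorem not_missing_of_ne [DecidableEq E] [Finite X] (hloop : ∀ e, ¬ (ends e).IsDiag)
    (hc : Proper ends D c) (hno : ¬ ∃ c' : E → C, Proper ends (insert e₀ D) c')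
    (hb : Missing ends D c x b) (hf : IsFanEdge ends D c x e₀ f z)
    (hg : IsFanEdge ends D c x e₀ g w) (hzw : z ≠ w) (hz : Missing ends D c z a) :
    ¬ Missing ends D c w a := by
  classical
  have := Fintype.ofFinite X
  intro hw
  have hcard : ({x, z, w} : Finset X).card = 3 := Finset.card_eq_three.2
    ⟨x, z, w, hf.center_ne_end hloop, hg.center_ne_end hloop, hzw, rfl⟩
  have hle : ({x, z, w} : Finset X).card ≤ 2 := by
    refine card_reachable_degree_le_one_le_two (x := x) (degree_kempeGraph_le_two hc a b) ?_ ?_ <;>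
      simp only [Finset.mem_insert, Finset.mem_singleton, forall_eq_or_imp, forall_eq]
    · obtain ⟨n, s, y, hf, -, rfl⟩ := hf
      obtain ⟨m, s', y', hg, -, rfl⟩ := hg
      exact ⟨.refl _, hf.reachable hno hc hb hz, hg.reachable hno hc hb hw⟩
    · exact ⟨degree_kempeGraph_le_one hc (.inr rfl) hb, degree_kempeGraph_le_one hc (.inl rfl) hz,
        degree_kempeGraph_le_one hc (.inl rfl) hw⟩
  omega

end IsFanEdge

open Classical in
theorem le_card_missing [Finite E] [Fintype C] {k : ℕ} (v : X)
    (hk : {e | v ∈ ends e}.ncard + k ≤ Fintype.card C) :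
    k ≤ (Finset.univ.filter fun a => Missing ends D c v a).card := by
  have hused : (Finset.univ.filter fun a => ¬ Missing ends D c v a) ⊆
      {e | v ∈ ends e}.toFinite.toFinset.image c := by
    intro a ha
    simp only [Missing, Finset.mem_filter, Finset.mem_univ, true_and, not_forall, not_not] at ha
    obtain ⟨e, _, he, rfl⟩ := ha
    exact Finset.mem_image_of_mem _ (by simpa using he)
  have hle := (Finset.card_le_card hused).trans Finset.card_image_le
  rw [← Set.ncard_eq_toFinset_card] at hle
  have hsum := Finset.card_filter_add_card_filter_not (s := (Finset.univ : Finset C))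
    (p := fun a => Missing ends D c v a)
  rw [Finset.card_univ] at hsum
  omega

open Classical in
theorem card_isFanEdge_le [Fintype E] [Fintype X] {μ : ℕ}
    (hμ : ∀ e, {e' | ends e' = ends e}.ncard ≤ μ) :
    (Finset.univ.filter fun f => ∃ z, IsFanEdge ends D c x e₀ f z).card ≤
      (Finset.univ.filter fun z => ∃ f, IsFanEdge ends D c x e₀ f z).card * μ := by
  have hsub : (Finset.univ.filter fun f => ∃ z, IsFanEdge ends D c x e₀ f z) ⊆
      (Finset.univ.filter fun z => ∃ f, IsFanEdge ends D c x e₀ f z).biUnion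
        fun z => Finset.univ.filter fun e => ends e = s(x, z) := by
    intro f hf
    obtain ⟨z, hz⟩ := (Finset.mem_filter.1 hf).2
    exact Finset.mem_biUnion.2 ⟨z, by simpa using ⟨f, hz⟩, by simpa using hz.ends_eq⟩
  refine (Finset.card_le_card hsub).trans (Finset.card_biUnion_le_card_mul _ _ _ fun z hz => ?_)
  obtain ⟨f, hf⟩ := (Finset.mem_filter.1 hz).2
  simpa [hf.ends_eq, Set.ncard_eq_toFinset_card'] using hμ f

open Classical in
theorem card_biUnion_missing_lt [Fintype E] [Fintype X] [Fintype C] (hc : Proper ends D c)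
    (hno : ¬ ∃ c' : E → C, Proper ends (insert e₀ D) c') (he₀ : e₀ ∉ D) (hx : x ∈ ends e₀) :
    ((Finset.univ.filter fun z => ∃ f, IsFanEdge ends D c x e₀ f z).biUnion
        fun z => Finset.univ.filter fun a => Missing ends D c z a).card <
      (Finset.univ.filter fun f => ∃ z, IsFanEdge ends D c x e₀ f z).card := by
  set F := Finset.univ.filter fun f => ∃ z, IsFanEdge ends D c x e₀ f z
  have hmem : e₀ ∈ F := by
    obtain ⟨z, hz⟩ := Sym2.mem_iff_exists.1 hx
    simpa [F] using ⟨z, isFanEdge_start hz⟩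
  refine lt_of_le_of_lt ?_ (Finset.card_erase_lt_of_mem hmem)
  refine (Finset.card_le_card fun a ha => ?_).trans (Finset.card_image_le (f := c))
  simp only [Finset.mem_biUnion, Finset.mem_filter, Finset.mem_univ, true_and] at ha
  obtain ⟨z, ⟨f, hf⟩, hz⟩ := ha
  have hnot := hf.not_missing_center hc hno hz
  simp only [Missing, not_forall, not_not] at hnot
  obtain ⟨g, hg, hxg, rfl⟩ := hnot
  refine Finset.mem_image_of_mem _ (Finset.mem_erase.2 ⟨fun h => he₀ (h ▸ hg), ?_⟩)
  simpa [F] using hf.step hg hxg hz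

open Classical in
theorem Proper.exists_insert [Finite E] [Finite X] [Fintype C]
    (hloop : ∀ e, ¬ (ends e).IsDiag) {Δ μ : ℕ} (hΔ : ∀ v, {e | v ∈ ends e}.ncard ≤ Δ)
    (hμ : ∀ e, {e' | ends e' = ends e}.ncard ≤ μ) (hC : Δ + μ ≤ Fintype.card C)
    (he₀ : e₀ ∉ D) (hc : Proper ends D c) : ∃ c' : E → C, Proper ends (insert e₀ D) c' := by
  have := Fintype.ofFinite E
  have := Fintype.ofFinite X
  by_contra hno
  obtain ⟨x, hx⟩ : ∃ x, x ∈ ends e₀ := ⟨_, Sym2.out_fst_mem _⟩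
  have hmiss : ∀ v, μ ≤ (Finset.univ.filter fun a => Missing ends D c v a).card := fun v =>
    le_card_missing v ((Nat.add_le_add_right (hΔ v) μ).trans hC)
  have hμ0 : 0 < μ :=
    ((Set.ncard_pos (s := {e | ends e = ends e₀}) (Set.toFinite _)).2 ⟨e₀, rfl⟩).trans_le (hμ e₀)
  obtain ⟨b, hb⟩ := Finset.card_pos.1 (hμ0.trans_le (hmiss x))
  replace hb : Missing ends D c x b := (Finset.mem_filter.1 hb).2
  set Z := Finset.univ.filter fun z => ∃ f, IsFanEdge ends D c x e₀ f z
  have hdisj : (Z : Set X).PairwiseDisjoint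
      fun z => Finset.univ.filter fun a => Missing ends D c z a := by
    intro z hz w hw hzw
    obtain ⟨f, hf⟩ := (Finset.mem_filter.1 hz).2
    obtain ⟨g, hg⟩ := (Finset.mem_filter.1 hw).2
    refine Finset.disjoint_left.2 fun a ha ha' => ?_
    exact IsFanEdge.not_missing_of_ne hloop hc hno hb hf hg hzw (Finset.mem_filter.1 ha).2
      (Finset.mem_filter.1 ha').2
  have hle := Finset.card_nsmul_le_sum Z _ _ fun z _ => hmiss z
  rw [← Finset.card_biUnion hdisj, smul_eq_mul] at hle
  exact absurd ((card_isFanEdge_le hμ).trans hle)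
    (not_le_of_gt (card_biUnion_missing_lt hc hno he₀ hx))

end FanEdge

/-- **Vizing's theorem** for multigraphs with maximum degree `Δ` and maximum multiplicity `μ`. -/
theorem exists_coloring [Finite E] [Finite X] (hloop : ∀ e, ¬ (ends e).IsDiag)
    {Δ μ : ℕ} (hΔ : ∀ v, {e | v ∈ ends e}.ncard ≤ Δ)
    (hμ : ∀ e, {e' | ends e' = ends e}.ncard ≤ μ) :
    ∃ c : E → Fin (Δ + μ), ∀ e e', e ≠ e' → ∀ v, v ∈ ends e → v ∈ ends e' → c e ≠ c e' := by
  classical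
  have := Fintype.ofFinite E
  have hcolor : ∀ D : Finset E, ∃ c : E → Fin (Δ + μ), Proper ends D c := by
    intro D
    induction D using Finset.induction_on with
    | empty =>
      have hμ0 : E → 0 < μ := fun e =>
        ((Set.ncard_pos (s := {e' | ends e' = ends e}) (Set.toFinite _)).2 ⟨e, rfl⟩).trans_le (hμ e)
      exact ⟨fun e => ⟨0, Nat.add_pos_right Δ (hμ0 e)⟩, by simp [Proper]⟩
    | insert e₀ D he₀ ih =>
      obtain ⟨c, hc⟩ := ih
      exact hc.exists_insert hloop hΔ hμ (Fintype.card_fin _).ge he₀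
  obtain ⟨c, hc⟩ := hcolor Finset.univ
  exact ⟨c, fun e e' => hc e (Finset.mem_univ _) e' (Finset.mem_univ _)⟩

end EdgeColoring

/-! ### Edge connectivity of 3-connected plane graphs -/

section EdgeConnected

variable {V : Type*} {H : SimpleGraph V} {k : ℕ}

theorem reachable_induce_deleteEdges_insert {F : Set (Sym2 V)} {T : Set V} {u v : V}
    (hpre : ((H.deleteEdges F).induce (insert u T)ᶜ).Preconnected) {a b : V} (ha : a ∉ insert u T)
    (hb : b ∉ insert u T) :
    ((H.deleteEdges (insert s(u, v) F)).induce Tᶜ).Reachable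
      ⟨a, fun h => ha (Set.mem_insert_of_mem u h)⟩
      ⟨b, fun h => hb (Set.mem_insert_of_mem u h)⟩ := by
  let φ : (H.deleteEdges F).induce (insert u T)ᶜ →g
      (H.deleteEdges (insert s(u, v) F)).induce Tᶜ :=
    { toFun := fun x => ⟨x.1, fun h => x.2 (Set.mem_insert_of_mem u h)⟩
      map_rel' := by
        rintro ⟨x, hx⟩ ⟨y, hy⟩ hxy
        simp only [SimpleGraph.induce_adj, SimpleGraph.deleteEdges_adj, Set.mem_insert_iff,
          Set.mem_compl_iff] at hxy hx hy ⊢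
        grind }
  exact (hpre ⟨a, ha⟩ ⟨b, hb⟩).map φ

theorem induce_deleteEdges_insert_eq {F : Set (Sym2 V)} {T : Set V} {u v : V} (hu : u ∈ T) :
    (H.deleteEdges (insert s(u, v) F)).induce Tᶜ = (H.deleteEdges F).induce Tᶜ := by
  ext ⟨x, hx⟩ ⟨y, hy⟩
  simp only [SimpleGraph.induce_adj, SimpleGraph.deleteEdges_adj, Set.mem_insert_iff,
    Set.mem_compl_iff] at hx hy ⊢
  grind

/-- Instead of an edge, one may delete either of its ends; a third vertex then links the two
resulting connected graphs. -/
theorem preconnected_induce_deleteEdges (hk : k < Nat.card V)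
    (hH : ∀ S : Set V, S.ncard < k → (H.induce Sᶜ).Preconnected) (F : Finset (Sym2 V)) {T : Set V}
    (hFT : T.ncard + F.card < k) : ((H.deleteEdges F).induce Tᶜ).Preconnected := by
  classical
  have := Nat.finite_of_card_ne_zero (Nat.ne_zero_of_lt hk)
  induction F using Finset.induction_on generalizing T with
  | empty => simpa using hH T hFT
  | insert e F he ih =>
    rw [Finset.card_insert_of_notMem he] at hFT
    rw [Finset.coe_insert]
    induction e with | _ u v
    have ihT := ih (T := T) (by omega)
    by_cases hu : u ∈ T
    · rwa [induce_deleteEdges_insert_eq hu]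
    by_cases hv : v ∈ T
    · rwa [Sym2.eq_swap, induce_deleteEdges_insert_eq hv]
    have ih' (x) : ((H.deleteEdges F).induce (insert x T)ᶜ).Preconnected :=
      ih ((Nat.add_le_add_right (Set.ncard_insert_le x T) _).trans_lt (by omega))
    rcases eq_or_ne u v with rfl | huv
    · convert ihT using 2
      ext x y
      simp only [SimpleGraph.deleteEdges_adj, Set.mem_insert_iff]
      grind [H.ne_of_adj]
    obtain ⟨c, hc⟩ : ∃ c, c ∉ insert u (insert v T) := by
      by_contra! hall
      have h1 := Set.ncard_insert_le u (insert v T)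
      have h2 := Set.ncard_insert_le v T
      rw [Set.eq_univ_of_forall hall, Set.ncard_univ] at h1
      omega
    simp only [Set.mem_insert_iff, not_or] at hc
    have hreach : ∀ a, (ha : a ∉ T) →
        ((H.deleteEdges (insert s(u, v) F)).induce Tᶜ).Reachable ⟨a, ha⟩ ⟨c, hc.2.2⟩ := by
      intro a ha
      rcases eq_or_ne a u with rfl | hau
      · rw [Sym2.eq_swap]
        exact reachable_induce_deleteEdges_insert (ih' v) (by simp [huv, ha]) (by simp [hc])
      · exact reachable_induce_deleteEdges_insert (ih' u) (by simp [hau, ha]) (by simp [hc])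
    exact fun a b => (hreach a a.2).trans (hreach b b.2).symm

theorem isEdgeConnected_of_preconnected_induce (hk : k < Nat.card V)
    (hH : ∀ S : Set V, S.ncard < k → (H.induce Sᶜ).Preconnected) : H.IsEdgeConnected k := by
  intro u v F hF
  have hfin := Set.finite_of_encard_le_coe hF.le
  have hcard : (∅ : Set V).ncard + hfin.toFinset.card < k := by
    rw [Set.ncard_empty, zero_add, ← Set.ncard_eq_toFinset_card F hfin]
    rwa [← hfin.cast_ncard_eq, Nat.cast_lt] at hF
  have h := preconnected_induce_deleteEdges hk hH _ hcard
  rw [hfin.coe_toFinset] at h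
  exact (h ⟨u, by simp⟩ ⟨v, by simp⟩).map (SimpleGraph.Embedding.induce _).toHom

theorem PlaneGraph.IsThreeConnected.isEdgeConnected {V : Type*} {R : PlaneGraph V}
    (h : R.IsThreeConnected) : R.graph.IsEdgeConnected 3 :=
  isEdgeConnected_of_preconnected_induce h.1 fun S hS => (h.2 S hS).preconnected

end EdgeConnected

/-! ### The dual multigraph of a plane graph -/

section Incidence

variable {E I J : Type*}

open Classical in
/-- The incidence matrix, modulo 2, of the multigraph with the given ends of edges. The row of a
loop vanishes. -/
noncomputable def incidence (ends : E → Sym2 I) : Matrix E I (ZMod 2) :=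
  Matrix.of fun e => Sym2.lift ⟨fun i j => Pi.single i 1 + Pi.single j 1, fun _ _ => add_comm _ _⟩
    (ends e)

variable {p : E → Sym2 I} {q : E → Sym2 J}

open Classical in
theorem incidence_apply_of_eq {e : E} {i j : I} (h : p e = s(i, j)) :
    incidence p e = Pi.single i 1 + Pi.single j 1 := by
  change Sym2.lift _ (p e) = _
  rw [h, Sym2.lift_mk]

theorem incidence_apply_of_isDiag {e : E} (h : (p e).IsDiag) : incidence p e = 0 := by
  classical
  induction hij : p e with | _ i j
  obtain rfl : i = j := by simpa [hij] using h
  rw [incidence_apply_of_eq hij]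
  exact funext fun _ => CharTwo.add_self_eq_zero _

variable [Fintype I] [Fintype J]

theorem incidence_mulVec_apply_of_eq {e : E} {i j : I} (h : p e = s(i, j)) (x : I → ZMod 2) :
    (incidence p).mulVec x e = x i + x j := by
  classical
  rw [Matrix.mulVec, incidence_apply_of_eq h, add_dotProduct, single_one_dotProduct,
    single_one_dotProduct]

theorem incidence_mulVec_eq_zero_iff {x : I → ZMod 2} :
    (incidence p).mulVec x = 0 ↔ ∀ e i j, p e = s(i, j) → x i = x j := by
  constructor
  · intro h e i j he
    have := congrFun h e
    rwa [incidence_mulVec_apply_of_eq he, Pi.zero_apply, CharTwo.add_eq_zero] at this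
  · intro h
    ext e
    induction he : p e with | _ i j
    rw [incidence_mulVec_apply_of_eq he, Pi.zero_apply, CharTwo.add_eq_zero]
    exact h e i j he

theorem rank_incidence_add_one [Finite E] [Nonempty I]
    (hp : ∀ x : I → ZMod 2, (∀ e i j, p e = s(i, j) → x i = x j) → ∀ i j, x i = x j) :
    (incidence p).rank + 1 = Fintype.card I := by
  have hker : LinearMap.ker (incidence p).mulVecLin = Submodule.span (ZMod 2) {1} := by
    ext x
    rw [LinearMap.mem_ker, Matrix.mulVecLin_apply, incidence_mulVec_eq_zero_iff,
      Submodule.mem_span_singleton]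
    constructor
    · intro h
      exact ⟨x (Classical.arbitrary I), funext fun i => by simpa using hp x h _ i⟩
    · rintro ⟨a, rfl⟩ e i j -
      rfl
  have hrank := (incidence p).mulVecLin.finrank_range_add_finrank_ker
  rwa [hker, finrank_span_singleton one_ne_zero, Module.finrank_fintype_fun_eq_card] at hrank

theorem exists_incidence_mulVec_eq [Fintype E] [Nonempty I] [Nonempty J]
    (hp : ∀ x : I → ZMod 2, (∀ e i j, p e = s(i, j) → x i = x j) → ∀ i j, x i = x j)
    (hq : ∀ x : J → ZMod 2, (∀ e i j, q e = s(i, j) → x i = x j) → ∀ i j, x i = x j)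
    (hqp : (incidence q).transpose * incidence p = 0)
    (hcard : Fintype.card I + Fintype.card J = Fintype.card E + 2) {y : E → ZMod 2}
    (hy : (incidence q).transpose.mulVec y = 0) : ∃ x, (incidence p).mulVec x = y := by
  have hle : LinearMap.range (incidence p).mulVecLin ≤
      LinearMap.ker (incidence q).transpose.mulVecLin := by
    rw [LinearMap.range_le_ker_iff, ← Matrix.mulVecLin_mul, hqp, Matrix.mulVecLin_zero]
  have hker := (incidence q).transpose.mulVecLin.finrank_range_add_finrank_ker
  have hq_rank := rank_incidence_add_one hq
  have hp_rank : Module.finrank _ (LinearMap.range (incidence p).mulVecLin) + 1 = _ :=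
    rank_incidence_add_one hp
  rw [← Matrix.rank_transpose, Matrix.rank] at hq_rank
  rw [Module.finrank_fintype_fun_eq_card] at hker
  have heq := Submodule.eq_of_le_of_finrank_eq hle (by omega)
  exact LinearMap.mem_range.1 (heq ▸ LinearMap.mem_ker.2 hy)

end Incidence

theorem apply_eq_of_sameCycle {α β : Type*} {p : Equiv.Perm α} {φ : α → β}
    (hφ : ∀ a, φ (p a) = φ a) {a b : α} (h : p.SameCycle a b) : φ a = φ b := by
  obtain ⟨n, rfl⟩ := h
  induction n generalizing a with
  | zero => rfl
  | succ n ih => rw [zpow_add_one, Equiv.Perm.mul_apply, ← ih, hφ]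
  | pred n ih =>
    rw [zpow_sub_one, Equiv.Perm.mul_apply, ← ih, ← hφ (p⁻¹ a)]
    exact (congrArg φ (p.apply_symm_apply a)).symm

namespace PlaneGraph

variable {V : Type u} (G : PlaneGraph V)

theorem faceOf_facePerm (d : G.graph.Dart) : G.faceOf (G.facePerm d) = G.faceOf d :=
  Quotient.sound ((Equiv.Perm.SameCycle.refl _ _).apply_left)

theorem facePerm_fst (d : G.graph.Dart) : (G.facePerm d).fst = d.snd :=
  G.rot_fst d.symm

variable {G} in
theorem apply_eq_of_faceOf_eq {α : Type*} {φ : G.graph.Dart → α}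
    (hφ : ∀ d, φ (G.facePerm d) = φ d) {d e : G.graph.Dart} (h : G.faceOf d = G.faceOf e) :
    φ d = φ e :=
  apply_eq_of_sameCycle hφ (Quotient.exact h)

instance [Finite V] : Finite G.graph.Dart :=
  Finite.of_injective _ SimpleGraph.Dart.toProd_injective

instance [Finite V] : Finite G.Face :=
  inferInstanceAs (Finite (Quotient _))

/-- The edge through which a dart passes. -/
def edgeOf (d : G.graph.Dart) : G.graph.edgeSet :=
  ⟨d.edge, d.edge_mem⟩

theorem coe_edgeOf (d : G.graph.Dart) : (G.edgeOf d : Sym2 V) = s(d.fst, d.snd) :=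
  rfl

variable {G} in
theorem edgeOf_eq_edgeOf_iff {d e : G.graph.Dart} :
    G.edgeOf d = G.edgeOf e ↔ d = e ∨ d = e.symm :=
  Subtype.ext_iff.trans (SimpleGraph.dart_edge_eq_iff d e)

theorem edgeOf_symm (d : G.graph.Dart) : G.edgeOf d.symm = G.edgeOf d :=
  edgeOf_eq_edgeOf_iff.2 (Or.inr rfl)

theorem edgeOf_surjective : Function.Surjective G.edgeOf := by
  rintro ⟨e, he⟩
  induction e with | _ a b => exact ⟨⟨(a, b), he⟩, rfl⟩

/-- The dual multigraph: the vertices are the faces, and an edge joins the faces on its two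
sides. -/
noncomputable def dualEnds (e : G.graph.edgeSet) : Sym2 G.Face :=
  let d := Function.surjInv G.edgeOf_surjective e
  s(G.faceOf d, G.faceOf d.symm)

theorem dualEnds_edgeOf (d : G.graph.Dart) :
    G.dualEnds (G.edgeOf d) = s(G.faceOf d, G.faceOf d.symm) := by
  rcases edgeOf_eq_edgeOf_iff.1 (Function.surjInv_eq G.edgeOf_surjective (G.edgeOf d)) with h | h
  · simp only [dualEnds, h]
  · simp only [dualEnds, h, SimpleGraph.Dart.symm_symm, Sym2.eq_swap]

theorem eq_of_forall_dart_eq {α : Type*} {x : V → α} (hx : ∀ d : G.graph.Dart, x d.fst = x d.snd)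
    (v w : V) : x v = x w := by
  obtain ⟨p⟩ := G.connected.preconnected v w
  induction p with
  | nil => rfl
  | cons h _ ih => exact (hx ⟨(_, _), h⟩).trans ih

theorem face_eq_of_forall_dart_eq {α : Type*} {s : G.Face → α}
    (hs : ∀ d, s (G.faceOf d) = s (G.faceOf d.symm)) (f g : G.Face) : s f = s g := by
  have hrot (d : G.graph.Dart) : s (G.faceOf (G.rot d)) = s (G.faceOf d) := by
    rw [hs d, ← G.faceOf_facePerm d.symm, facePerm, Equiv.trans_apply,
      Function.Involutive.coe_toPerm, SimpleGraph.Dart.symm_symm]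
  have hvertex {d e : G.graph.Dart} (h : d.fst = e.fst) : s (G.faceOf d) = s (G.faceOf e) :=
    apply_eq_of_sameCycle (φ := fun d => s (G.faceOf d)) hrot (G.rot_cyclic d e h)
  have hwalk {v w : V} (p : G.graph.Walk v w) : ∀ d e : G.graph.Dart, d.fst = v → e.fst = w →
      s (G.faceOf d) = s (G.faceOf e) := by
    induction p with
    | nil => exact fun d e hd he => hvertex (hd.trans he.symm)
    | @cons a b c h _ ih =>
      intro d e hd he
      rw [hvertex (e := ⟨(a, b), h⟩) hd, hs]
      exact ih _ _ rfl he
  obtain ⟨d, rfl⟩ : ∃ d, G.faceOf d = f := Quotient.exists_rep f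
  obtain ⟨e, rfl⟩ : ∃ e, G.faceOf e = g := Quotient.exists_rep g
  obtain ⟨p⟩ := G.connected.preconnected d.fst e.fst
  exact hwalk p d e rfl rfl

theorem nonempty_face : Nonempty G.Face := by
  by_contra h
  have hdart : IsEmpty G.graph.Dart := ⟨fun d => h ⟨G.faceOf d⟩⟩
  have hface : IsEmpty G.Face := not_nonempty_iff.1 h
  have hedge : IsEmpty G.graph.edgeSet := (Function.surjInv G.edgeOf_surjective).isEmpty
  have := G.connected.nonempty
  have hV : Subsingleton V := ⟨G.eq_of_forall_dart_eq hdart.elim⟩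
  have heuler : (Nat.card V : ℤ) - Nat.card G.graph.edgeSet + Nat.card G.Face = 2 := G.euler
  simp at heuler

theorem sum_incidence_dualEnds_mul [Fintype G.graph.Dart] [Fintype G.graph.edgeSet]
    [DecidableEq G.Face] (f : G.Face) (y : G.graph.edgeSet → ZMod 2) :
    ∑ e, incidence G.dualEnds e f * y e =
      ∑ d, if G.faceOf d = f then y (G.edgeOf d) else 0 := by
  classical
  rw [← Finset.sum_fiberwise (s := Finset.univ) (g := G.edgeOf)]
  refine Finset.sum_congr rfl fun e _ => ?_
  obtain ⟨d, rfl⟩ := G.edgeOf_surjective e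
  have hfiber : Finset.univ.filter (fun d' => G.edgeOf d' = G.edgeOf d) = {d, d.symm} := by
    ext d'
    simp [edgeOf_eq_edgeOf_iff]
  rw [hfiber, Finset.sum_pair d.symm_ne.symm, incidence_apply_of_eq (G.dualEnds_edgeOf d),
    edgeOf_symm]
  simp [Pi.single_apply, add_mul, eq_comm]

theorem transpose_incidence_dualEnds_mul_incidence [Finite V]
    [Fintype G.graph.edgeSet] :
    (incidence G.dualEnds).transpose * incidence (Subtype.val : G.graph.edgeSet → Sym2 V) = 0 := by
  classical
  have := Fintype.ofFinite G.graph.Dart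
  ext f v
  rw [Matrix.mul_apply]
  simp only [Matrix.transpose_apply, Matrix.zero_apply]
  rw [sum_incidence_dualEnds_mul]
  have hsum (d : G.graph.Dart) : (if G.faceOf d = f then
        incidence Subtype.val (G.edgeOf d) v else 0) =
      (if G.faceOf d = f ∧ d.fst = v then 1 else 0) +
        if G.faceOf (G.facePerm d) = f ∧ (G.facePerm d).fst = v then 1 else 0 := by
    rw [incidence_apply_of_eq (G.coe_edgeOf d), facePerm_fst, faceOf_facePerm]
    by_cases hd : G.faceOf d = f <;> simp [hd, Pi.single_apply, eq_comm]
  rw [Finset.sum_congr rfl fun d _ => hsum d, Finset.sum_add_distrib,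
    Equiv.sum_comp G.facePerm (fun d => if G.faceOf d = f ∧ d.fst = v then (1 : ZMod 2) else 0),
    CharTwo.add_self_eq_zero]

theorem card_vertex_add_card_face [Fintype V] [Fintype G.graph.edgeSet] [Fintype G.Face] :
    Fintype.card V + Fintype.card G.Face = Fintype.card G.graph.edgeSet + 2 := by
  have heuler : (Nat.card V : ℤ) - Nat.card G.graph.edgeSet + Nat.card G.Face = 2 := G.euler
  simp only [Nat.card_eq_fintype_card] at heuler
  omega

variable {G}

/-- A set of edges that meets the boundary of every face evenly is a cut, by exactness. -/
theorem eq_zero_of_encard_support_lt [Finite V] [Fintype G.graph.edgeSet] {k : ℕ}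
    (hG : G.graph.IsEdgeConnected k) {y : G.graph.edgeSet → ZMod 2}
    (hy : (incidence G.dualEnds).transpose.mulVec y = 0) (hk : y.support.encard < k) : y = 0 := by
  have := Fintype.ofFinite V
  have := Fintype.ofFinite G.Face
  have := G.connected.nonempty
  have := G.nonempty_face
  obtain ⟨x, hx⟩ := exists_incidence_mulVec_eq (p := Subtype.val)
    (fun x hx => G.eq_of_forall_dart_eq fun d => hx _ _ _ (G.coe_edgeOf d))
    (fun s hs => G.face_eq_of_forall_dart_eq fun d => hs _ _ _ (G.dualEnds_edgeOf d))
    G.transpose_incidence_dualEnds_mul_incidence G.card_vertex_add_card_face hy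
  have hwalk {v w : V} (p : (G.graph.deleteEdges (Subtype.val '' y.support)).Walk v w) :
      x v = x w := by
    induction p with
    | nil => rfl
    | @cons a b c h _ ih =>
      obtain ⟨hab, hy⟩ := SimpleGraph.deleteEdges_adj.1 h
      replace hy : y (G.edgeOf ⟨(a, b), hab⟩) = 0 := by
        by_contra hne
        exact hy ⟨_, hne, rfl⟩
      rw [← hx, incidence_mulVec_apply_of_eq (G.coe_edgeOf _), CharTwo.add_eq_zero] at hy
      exact hy.trans ih
  rw [← hx, incidence_mulVec_eq_zero_iff]
  intro _ a b _
  obtain ⟨p⟩ := hG a b (s := Subtype.val '' y.support)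
    (by rwa [Subtype.val_injective.encard_image])
  exact hwalk p

theorem not_isDiag_dualEnds [Finite V] (hG : G.graph.IsEdgeConnected 2) (e : G.graph.edgeSet) :
    ¬ (G.dualEnds e).IsDiag := by
  classical
  have := Fintype.ofFinite G.graph.edgeSet
  intro he
  have hy := eq_zero_of_encard_support_lt hG (y := Pi.single e 1) (by
    ext f
    rw [Matrix.mulVec_single_one, Matrix.col_apply, Matrix.transpose_apply,
      incidence_apply_of_isDiag he])
    ((Set.encard_le_encard Pi.support_single_subset).trans_lt (by norm_num))
  simpa using congrFun hy e

/-- Two edges with the same faces on their sides form a cut. -/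
theorem dualEnds_injective [Finite V] (hG : G.graph.IsEdgeConnected 3) :
    Function.Injective G.dualEnds := by
  classical
  have := Fintype.ofFinite G.graph.edgeSet
  intro e e' he
  by_contra hne
  have hrow : incidence G.dualEnds e = incidence G.dualEnds e' := by
    induction h : G.dualEnds e with | _ f g
    rw [incidence_apply_of_eq h, incidence_apply_of_eq (he ▸ h)]
  have hsupport :
      Function.support (Pi.single e 1 + Pi.single e' 1 : _ → ZMod 2) ⊆ {e, e'} :=
    Function.support_subset_iff'.2 fun a ha => by
      rw [Set.mem_insert_iff, Set.mem_singleton_iff, not_or] at ha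
      simp [ha.1, ha.2]
  have hy := eq_zero_of_encard_support_lt hG (y := Pi.single e 1 + Pi.single e' 1) (by
    ext f
    rw [Matrix.mulVec_add, Matrix.mulVec_single_one, Matrix.mulVec_single_one]
    simp [hrow, CharTwo.add_self_eq_zero])
    ((Set.encard_le_encard hsupport).trans_lt (by rw [Set.encard_pair hne]; norm_num))
  simpa [Pi.single_eq_of_ne hne] using congrFun hy e

theorem exists_isCyclicColoring [Finite V] (G : PlaneGraph V) :
    ∃ c : V → Fin G.cyclicChromaticNumber, G.IsCyclicColoring c := by
  have hne : {k : ℕ | ∃ c : V → Fin k, G.IsCyclicColoring c}.Nonempty :=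
    ⟨Nat.card V, Finite.equivFin V, fun _ _ _ _ _ h => (Finite.equivFin V).injective.ne h⟩
  exact Nat.sInf_mem hne

theorem cyclicChromaticNumber_le {C : Type*} [Finite C] {c : V → C} (hc : G.IsCyclicColoring c) :
    G.cyclicChromaticNumber ≤ Nat.card C :=
  Nat.sInf_le ⟨fun v => Finite.equivFin C (c v),
    fun f x y hx hy hxy h => hc f x y hx hy hxy ((Finite.equivFin C).injective h)⟩

theorem cyclicChromaticNumber_eq_card [Finite V]
    (h : ∀ v w, ∃ f : G.Face, Incident v f ∧ Incident w f) :
    G.cyclicChromaticNumber = Nat.card V := by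
  refine le_antisymm (cyclicChromaticNumber_le (c := id) fun _ _ _ _ _ hxy => hxy) ?_
  obtain ⟨c, hc⟩ := G.exists_isCyclicColoring
  have hinj : Function.Injective c := fun v w hvw => by
    by_contra hne
    obtain ⟨f, hv, hw⟩ := h v w
    exact hc f v w hv hw hne hvw
  exact (Nat.card_le_card_of_injective c hinj).trans_eq (Nat.card_fin _)

theorem isThreeConnected_of_forall_adj (hV : 3 < Nat.card V)
    (h : ∀ v w, v ≠ w → G.graph.Adj v w) : G.IsThreeConnected := by
  refine ⟨hV, fun S hS => ?_⟩
  have hne : Nonempty (Sᶜ : Set V) := by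
    rw [Set.nonempty_coe_sort, Set.nonempty_compl]
    rintro rfl
    rw [Set.ncard_univ] at hS
    omega
  refine ⟨fun v w => ?_⟩
  by_cases hvw : v = w
  · rw [hvw]
  · exact SimpleGraph.Adj.reachable (h v.1 w.1 (Subtype.coe_ne_coe.2 hvw))

theorem length_lt_longestTwoPath [Finite V] {x y : V} {p : G.graph.Walk x y} (hp : p.IsPath)
    (h : ∀ w ∈ p.support, (G.graph.neighborSet w).ncard = 2) :
    p.length < G.longestTwoPath := by
  have := Fintype.ofFinite V
  rw [← Nat.succ_le_iff]
  refine le_csSup ⟨Fintype.card V, ?_⟩ ⟨x, y, p, hp, h, SimpleGraph.Walk.length_support p⟩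
  rintro _ ⟨x, y, p, hp, -, rfl⟩
  rw [SimpleGraph.Walk.length_support]
  exact hp.length_lt

end PlaneGraph

/-! ### Coloring a subdivision -/

namespace PlaneSubdivision

variable {V : Type u} {W : Type v} {R : PlaneGraph V} {G : PlaneGraph W}
  (S : PlaneSubdivision R G) (d : R.graph.Dart)

theorem darts_getElem {i : ℕ} (hi : i < (S.path d).darts.length) :
    ((S.path d).darts[i]).fst = (S.path d).getVert i ∧
      ((S.path d).darts[i]).snd = (S.path d).getVert (i + 1) := by
  simp [SimpleGraph.Walk.darts_getElem_eq_getVert]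

theorem mem_support_symm {w : W} : w ∈ (S.path d.symm).support ↔ w ∈ (S.path d).support := by
  have h : (S.path d.symm).support = (S.path d).reverse.support :=
    congrArg (fun p => SimpleGraph.Walk.support p) (S.path_symm d)
  rw [h, SimpleGraph.Walk.support_reverse, List.mem_reverse]

variable {d} in
theorem getVert_inj {i j : ℕ} (hi : i ≤ (S.path d).length) (hj : j ≤ (S.path d).length)
    (h : (S.path d).getVert i = (S.path d).getVert j) : i = j :=
  (S.path_isPath d).getVert_injOn hi hj h

theorem getVert_mem_range {i : ℕ} (hi : i ≤ (S.path d).length)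
    (h : (S.path d).getVert i ∈ Set.range S.branch) : i = 0 ∨ i = (S.path d).length := by
  obtain ⟨x, hx⟩ := h
  rcases S.branch_mem_path d x (hx ▸ SimpleGraph.Walk.getVert_mem_support _ _) with rfl | rfl
  · exact Or.inl (S.getVert_inj hi (by omega) (by rw [← hx]; simp))
  · exact Or.inr (S.getVert_inj hi le_rfl (by rw [← hx]; simp))

theorem length_path_pos : 0 < (S.path d).length :=
  SimpleGraph.Walk.not_nil_iff_lt_length.1 (S.not_nil d)

theorem eq_or_eq_symm {d e : R.graph.Dart} {w : W} (hw : w ∉ Set.range S.branch)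
    (hd : w ∈ (S.path d).support) (he : w ∈ (S.path e).support) : e = d ∨ e = d.symm := by
  rw [← SimpleGraph.dart_edge_eq_iff]
  by_contra h
  exact hw (S.path_disjoint e d w he hd h)

theorem eq_of_fst_eq_getVert {i : ℕ} (hi : i + 1 < (S.path d).darts.length) {k : G.graph.Dart}
    (hk : k.fst = (S.path d).getVert (i + 1)) :
    k = ((S.path d).darts[i]).symm ∨ k = (S.path d).darts[i + 1] := by
  have hl : (S.path d).darts.length = (S.path d).length := SimpleGraph.Walk.length_darts _
  have hnb : (S.path d).getVert (i + 1) ∉ Set.range S.branch := by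
    intro h
    have := S.getVert_mem_range d (by omega) h
    omega
  obtain ⟨e, he⟩ := S.exists_path k
  have hke := SimpleGraph.Walk.dart_fst_mem_support_of_mem_darts _ he
  rw [hk] at hke
  rcases S.eq_or_eq_symm hnb (SimpleGraph.Walk.getVert_mem_support _ _) hke with rfl | rfl
  · right
    obtain ⟨j, hj, rfl⟩ := List.getElem_of_mem he
    rw [(S.darts_getElem e hj).1] at hk
    obtain rfl := S.getVert_inj (by omega) (by omega) hk
    rfl
  · left
    rw [S.mem_path_symm] at he
    obtain ⟨j, hj, hjk⟩ := List.getElem_of_mem he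
    have h1 : k.symm.snd = (S.path d).getVert (j + 1) := by rw [← hjk, (S.darts_getElem d hj).2]
    have h2 := S.getVert_inj (by omega) (by omega) (hk.symm.trans h1)
    obtain rfl : i = j := by omega
    rw [hjk, SimpleGraph.Dart.symm_symm]

theorem facePerm_getElem {i : ℕ} (hi : i + 1 < (S.path d).darts.length) :
    G.facePerm (S.path d).darts[i] = (S.path d).darts[i + 1] := by
  have h1 := (S.darts_getElem d (by omega : i < _)).2
  have h2 : G.facePerm (S.path d).darts[i] = G.rot ((S.path d).darts[i]).symm := rfl
  rcases S.eq_of_fst_eq_getVert d hi ((G.facePerm_fst _).trans h1) with h | h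
  · have hs : G.rot.SameCycle ((S.path d).darts[i]).symm (S.path d).darts[i + 1] :=
      G.rot_cyclic _ _ (by rw [(S.darts_getElem d hi).1]; exact h1)
    obtain ⟨n, hn⟩ := hs
    rw [← hn, h]
    exact (Function.IsFixedPt.perm_zpow (h2.symm.trans h) n).symm
  · exact h

/-- The first dart of the path that replaces a dart. -/
noncomputable def first : G.graph.Dart :=
  (S.path d).firstDart (S.not_nil d)

theorem first_eq_getElem :
    S.first d = (S.path d).darts[0]'(by
      rw [SimpleGraph.Walk.length_darts]; exact S.length_path_pos d) := by
  rw [first, ← SimpleGraph.Walk.head_darts_eq_firstDart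
    (SimpleGraph.Walk.darts_eq_nil.not.2 (S.not_nil _)), List.head_eq_getElem]

theorem first_mem : S.first d ∈ (S.path d).darts := by
  rw [first_eq_getElem]
  exact List.getElem_mem _

theorem faceOf_getElem {i : ℕ} (hi : i < (S.path d).darts.length) :
    G.faceOf (S.path d).darts[i] = G.faceOf (S.first d) := by
  induction i with
  | zero => rw [S.first_eq_getElem]
  | succ i ih => rw [← S.facePerm_getElem d hi, G.faceOf_facePerm, ih (by omega)]

variable {d} in
theorem faceOf_of_mem {g : G.graph.Dart} (hg : g ∈ (S.path d).darts) :
    G.faceOf g = G.faceOf (S.first d) := by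
  obtain ⟨i, hi, rfl⟩ := List.getElem_of_mem hg
  exact S.faceOf_getElem d hi

theorem facePerm_lastDart :
    G.facePerm ((S.path d).lastDart (S.not_nil d)) = S.first (R.facePerm d) := by
  have h1 : ((S.path d).lastDart (S.not_nil d)).symm = S.first d.symm := by
    apply SimpleGraph.Dart.ext
    apply Prod.ext
    · rfl
    · have : (S.path d.symm).snd = (S.path d).penultimate := by
        rw [S.path_symm]
        exact SimpleGraph.Walk.snd_reverse _
      exact this.symm
  have h2 : G.facePerm ((S.path d).lastDart (S.not_nil d)) = G.rot (S.first d.symm) := by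
    rw [← h1]
    rfl
  rw [h2]
  exact S.rot_firstDart _ (S.not_nil _) (S.not_nil _)

theorem faceOf_first_facePerm : G.faceOf (S.first (R.facePerm d)) = G.faceOf (S.first d) := by
  rw [← facePerm_lastDart, G.faceOf_facePerm]
  apply S.faceOf_of_mem
  have h := S.length_path_pos d
  rw [SimpleGraph.Walk.lastDart_eq (S.not_nil d)
    (by rw [SimpleGraph.Walk.length_darts]; omega)]
  exact List.getElem_mem _

variable {d} in
theorem origFace_faceOf {g : G.graph.Dart} (hg : g ∈ (S.path d).darts) :
    S.origFace (G.faceOf g) = R.faceOf d :=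
  ((S.existsUnique_corresponds (G.faceOf g)).choose_spec.2 _ ⟨d, g, hg, rfl, rfl⟩).symm

theorem eq_faceOf_first {f : G.Face} (h : S.origFace f = R.faceOf d) :
    f = G.faceOf (S.first d) := by
  obtain ⟨g, rfl⟩ : ∃ g, G.faceOf g = f := Quotient.exists_rep f
  obtain ⟨e, he⟩ := S.exists_path g
  rw [S.origFace_faceOf he] at h
  rw [S.faceOf_of_mem he]
  exact PlaneGraph.apply_eq_of_faceOf_eq (φ := fun d => G.faceOf (S.first d))
    S.faceOf_first_facePerm h

theorem incident_branch {x : V} {f : G.Face} :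
    PlaneGraph.Incident (S.branch x) f ↔ PlaneGraph.Incident x (S.origFace f) := by
  constructor
  · rintro ⟨g, hg, rfl⟩
    obtain ⟨d, hd⟩ := S.exists_path g
    refine ⟨d, ?_, (S.origFace_faceOf hd).symm⟩
    obtain ⟨i, hi, rfl⟩ := List.getElem_of_mem hd
    have hl : (S.path d).darts.length = (S.path d).length := SimpleGraph.Walk.length_darts _
    rw [(S.darts_getElem d hi).1] at hg
    rcases S.getVert_mem_range d (by omega) ⟨x, hg.symm⟩ with rfl | h
    · exact S.branch.injective (by rw [← hg]; simp)
    · omega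
  · rintro ⟨d, rfl, hd⟩
    refine ⟨S.first d, rfl, (S.eq_faceOf_first d hd.symm).symm⟩

/-- The new vertices: the inner vertices of the paths that replace the edges. -/
abbrev NewVertex : Type v :=
  {w : W // w ∉ Set.range S.branch}

/-- The vertices of a subdivision are the old ones and the new ones. -/
noncomputable def vertexEquiv : V ⊕ S.NewVertex ≃ W := by
  classical
  exact ((Equiv.ofInjective _ S.branch.injective).sumCongr (Equiv.refl _)).trans
    (Equiv.Set.sumCompl _)

theorem exists_mem_support (w : S.NewVertex) : ∃ d, w.1 ∈ (S.path d).support :=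
  (S.vertex_covered w).resolve_left w.2

/-- The edge of the original graph that a new vertex subdivides. -/
noncomputable def oldEdge (w : S.NewVertex) : R.graph.edgeSet :=
  R.edgeOf (S.exists_mem_support w).choose

variable {S d} in
theorem oldEdge_eq_edgeOf_iff {w : S.NewVertex} :
    S.oldEdge w = R.edgeOf d ↔ w.1 ∈ (S.path d).support := by
  have hw := (S.exists_mem_support w).choose_spec
  constructor
  · intro h
    rcases PlaneGraph.edgeOf_eq_edgeOf_iff.1 h with h | h
    · rwa [h] at hw
    · rwa [h, S.mem_support_symm] at hw
  · intro hd
    by_contra h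
    exact w.2 (S.path_disjoint _ _ _ hw hd fun h' => h (Subtype.ext h'))

theorem incident_newVertex {w : S.NewVertex} {f : G.Face} :
    PlaneGraph.Incident w.1 f ↔ S.origFace f ∈ R.dualEnds (S.oldEdge w) := by
  constructor
  · rintro ⟨g, hgw, rfl⟩
    obtain ⟨d, hd⟩ := S.exists_path g
    have hw : S.oldEdge w = R.edgeOf d := oldEdge_eq_edgeOf_iff.2
      (hgw ▸ SimpleGraph.Walk.dart_fst_mem_support_of_mem_darts _ hd)
    rw [S.origFace_faceOf hd, hw, R.dualEnds_edgeOf]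
    exact Sym2.mem_mk_left _ _
  · intro hf
    obtain ⟨d, hw, hd⟩ : ∃ d, S.oldEdge w = R.edgeOf d ∧ S.origFace f = R.faceOf d := by
      obtain ⟨d, hd⟩ := R.edgeOf_surjective (S.oldEdge w)
      rw [← hd, R.dualEnds_edgeOf, Sym2.mem_iff] at hf
      rcases hf with hf | hf
      · exact ⟨d, hd.symm, hf⟩
      · exact ⟨d.symm, hd.symm.trans (R.edgeOf_symm d).symm, hf⟩
    obtain ⟨i, hi, hil⟩ :=
      SimpleGraph.Walk.mem_support_iff_exists_getVert.1 (oldEdge_eq_edgeOf_iff.1 hw)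
    have hlast : i ≠ (S.path d).length := by
      rintro rfl
      exact w.2 ⟨d.snd, by simp [← hi]⟩
    have hil' : i < (S.path d).darts.length := by
      rw [SimpleGraph.Walk.length_darts]
      omega
    exact ⟨(S.path d).darts[i], (S.darts_getElem d hil').1.trans hi,
      (S.faceOf_getElem d hil').trans (S.eq_faceOf_first d hd).symm⟩

theorem faceDegree_eq [Finite W] (f : G.Face) :
    G.faceDegree f = R.faceDegree (S.origFace f) +
      {w : S.NewVertex | PlaneGraph.Incident w.1 f}.ncard := by
  have := Finite.of_injective _ S.branch.injective
  calc G.faceDegree f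
      = Nat.card {x : V ⊕ S.NewVertex // PlaneGraph.Incident (S.vertexEquiv x) f} :=
        (Nat.card_congr (S.vertexEquiv.subtypeEquiv fun _ => Iff.rfl)).symm
    _ = Nat.card {x : V // PlaneGraph.Incident (S.branch x) f} +
          Nat.card {w : S.NewVertex // PlaneGraph.Incident w.1 f} := by
        rw [Nat.card_congr Equiv.subtypeSum, Nat.card_sum]
        rfl
    _ = _ := by
        simp only [incident_branch]
        rfl

theorem le_maxExcess [Finite W] (f : G.Face) :
    (G.faceDegree f : ℤ) - R.faceDegree (S.origFace f) ≤ S.maxExcess :=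
  le_ciSup (f := fun f : G.Face => (G.faceDegree f : ℤ) - R.faceDegree (S.origFace f))
    (Set.finite_range _).bddAbove f

theorem ncard_mem_dualEnds_le [Finite W] (f' : R.Face) :
    ({w : S.NewVertex | f' ∈ R.dualEnds (S.oldEdge w)}.ncard : ℤ) ≤ S.maxExcess := by
  obtain ⟨d, rfl⟩ : ∃ d, R.faceOf d = f' := Quotient.exists_rep f'
  rw [← S.origFace_faceOf (S.first_mem d)]
  have := S.le_maxExcess (G.faceOf (S.first d))
  simp only [← incident_newVertex]
  rw [S.faceDegree_eq] at this
  push_cast at this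
  omega

theorem ncard_neighborSet_getVert {i : ℕ} (hi : i + 1 < (S.path d).length) :
    (G.graph.neighborSet ((S.path d).getVert (i + 1))).ncard = 2 := by
  have hl : (S.path d).darts.length = (S.path d).length := SimpleGraph.Walk.length_darts _
  rw [Set.ncard_eq_two]
  refine ⟨(S.path d).getVert i, (S.path d).getVert (i + 2), ?_, ?_⟩
  · intro h
    have := S.getVert_inj (by omega) (by omega) h
    omega
  · ext w
    simp only [SimpleGraph.mem_neighborSet, Set.mem_insert_iff, Set.mem_singleton_iff]
    constructor
    · intro h
      rcases S.eq_of_fst_eq_getVert d (i := i) (by omega) (k := ⟨(_, w), h⟩) rfl with h' | h'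
      · exact Or.inl ((congrArg (fun k : G.graph.Dart => k.snd) h').trans
          (S.darts_getElem d (by omega)).1)
      · exact Or.inr ((congrArg (fun k : G.graph.Dart => k.snd) h').trans
          (S.darts_getElem d (by omega)).2)
    · rintro (rfl | rfl)
      · exact ((S.path d).adj_getVert_succ (by omega)).symm
      · exact (S.path d).adj_getVert_succ (by omega)

theorem length_path_le [Finite W] : (S.path d).length ≤ G.longestTwoPath + 1 := by
  rcases Nat.lt_or_ge (S.path d).length 2 with h | h
  · omega
  have := PlaneGraph.length_lt_longestTwoPath (G := G)
    (p := ((S.path d).drop 1).take ((S.path d).length - 2))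
    (((S.path_isPath d).drop 1).take _) ?_
  · rw [SimpleGraph.Walk.take_length, SimpleGraph.Walk.drop_length] at this
    omega
  · intro w hw
    obtain ⟨i, rfl, hi⟩ := SimpleGraph.Walk.mem_support_iff_exists_getVert.1 hw
    rw [SimpleGraph.Walk.take_length, SimpleGraph.Walk.drop_length] at hi
    rw [SimpleGraph.Walk.take_getVert, SimpleGraph.Walk.drop_getVert, add_comm]
    exact S.ncard_neighborSet_getVert d (by omega)

theorem ncard_oldEdge_eq_le [Finite W] (e : R.graph.edgeSet) :
    {w : S.NewVertex | S.oldEdge w = e}.ncard ≤ G.longestTwoPath := by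
  classical
  obtain ⟨d, rfl⟩ := R.edgeOf_surjective e
  have hsub : Subtype.val '' {w : S.NewVertex | S.oldEdge w = R.edgeOf d} ⊆
      (Finset.Ioo 0 (S.path d).length).image (S.path d).getVert := by
    rintro _ ⟨⟨w, hw⟩, hwd, rfl⟩
    obtain ⟨i, rfl, hi⟩ :=
      SimpleGraph.Walk.mem_support_iff_exists_getVert.1 (oldEdge_eq_edgeOf_iff.1 hwd)
    refine Finset.mem_coe.2 (Finset.mem_image_of_mem _ (Finset.mem_Ioo.2 ⟨?_, ?_⟩))
    · refine Nat.pos_of_ne_zero ?_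
      rintro rfl
      exact hw ⟨d.fst, by simp⟩
    · refine lt_of_le_of_ne hi ?_
      rintro rfl
      exact hw ⟨d.snd, by simp⟩
  calc _ = _ := (Set.ncard_image_of_injective _ Subtype.val_injective).symm
    _ ≤ ((Finset.Ioo 0 (S.path d).length).image (S.path d).getVert).card := by
        rw [← Set.ncard_coe_finset]
        exact Set.ncard_le_ncard hsub
    _ ≤ (S.path d).length - 0 - 1 := Finset.card_image_le.trans_eq (Nat.card_Ioo _ _)
    _ ≤ G.longestTwoPath := by
        have := S.length_path_le d
        omega

theorem isCyclicColoring_sumMap {C C' : Type*} {c : V → C} {c' : S.NewVertex → C'}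
    (hc : R.IsCyclicColoring c) (hc' : ∀ w w', w ≠ w' → ∀ f, f ∈ R.dualEnds (S.oldEdge w) →
      f ∈ R.dualEnds (S.oldEdge w') → c' w ≠ c' w') :
    G.IsCyclicColoring (Sum.map c c' ∘ S.vertexEquiv.symm) := by
  intro f x y hx hy hxy
  obtain ⟨x, rfl⟩ := S.vertexEquiv.surjective x
  obtain ⟨y, rfl⟩ := S.vertexEquiv.surjective y
  simp only [Function.comp_apply, Equiv.symm_apply_apply]
  rcases x with x | w <;> rcases y with y | w'
  · have hne : x ≠ y := fun h => hxy (congrArg _ (congrArg _ h))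
    exact Sum.inl_injective.ne (hc _ _ _ (S.incident_branch.1 hx) (S.incident_branch.1 hy) hne)
  · exact Sum.inl_ne_inr
  · exact Sum.inr_ne_inl
  · have hne : w ≠ w' := fun h => hxy (congrArg _ (congrArg _ h))
    exact Sum.inr_injective.ne
      (hc' _ _ hne _ (S.incident_newVertex.1 hx) (S.incident_newVertex.1 hy))

theorem cyclicChromaticNumber_le [Finite W] (hR : R.graph.IsEdgeConnected 3) :
    (G.cyclicChromaticNumber : ℤ) ≤
      S.maxExcess + G.longestTwoPath + R.cyclicChromaticNumber := by
  have := Finite.of_injective _ S.branch.injective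
  obtain ⟨f'⟩ := R.nonempty_face
  obtain ⟨Δ, hΔ⟩ := Int.eq_ofNat_of_zero_le (Int.natCast_nonneg _ |>.trans
    (S.ncard_mem_dualEnds_le f'))
  obtain ⟨c, hc⟩ := R.exists_isCyclicColoring
  obtain ⟨c', hc'⟩ := EdgeColoring.exists_coloring
    (ends := fun w : S.NewVertex => R.dualEnds (S.oldEdge w)) (Δ := Δ) (μ := G.longestTwoPath)
    (fun w => PlaneGraph.not_isDiag_dualEnds (fun _ _ => (hR _ _).anti (by norm_num)) _)
    (fun f => by exact_mod_cast hΔ ▸ S.ncard_mem_dualEnds_le f)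
    (fun w => by
      simpa only [(PlaneGraph.dualEnds_injective hR).eq_iff] using S.ncard_oldEdge_eq_le _)
  have := PlaneGraph.cyclicChromaticNumber_le (S.isCyclicColoring_sumMap hc hc')
  rw [Nat.card_eq_fintype_card, Fintype.card_sum, Fintype.card_fin, Fintype.card_fin] at this
  omega

end PlaneSubdivision

/-! ### Plane graphs presented by darts -/

theorem sameCycle_iff_of_section {α β : Type*} {p : Equiv.Perm α} {φ : α → β} {ψ : β → α}
    (hφ : ∀ a, φ (p a) = φ a) (hψ : ∀ a, p.SameCycle a (ψ (φ a))) {a b : α} :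
    p.SameCycle a b ↔ φ a = φ b :=
  ⟨apply_eq_of_sameCycle hφ, fun h => (hψ a).trans (h ▸ (hψ b).symm)⟩

theorem sameCycle_permCongr_iff {α β : Type*} {p : Equiv.Perm α} (e : α ≃ β) {a b : β} :
    (e.permCongr p).SameCycle a b ↔ p.SameCycle (e.symm a) (e.symm b) := by
  refine exists_congr fun n => ?_
  have hpow : e.permCongr p ^ n = e.permCongr (p ^ n) := (map_zpow e.permCongrHom p n).symm
  rw [hpow, Equiv.permCongr_apply, ← Equiv.eq_symm_apply]

/-- A simple graph given by a type `D` of darts, the vertex from which each dart starts, and the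
reversal of darts. It serves to define graphs whose darts are enumerated by an inductive type. -/
structure DartGraph (D : Type*) (V : Type u) where
  /-- the vertex from which a dart starts -/
  src : D → V
  /-- the reversed dart -/
  rev : D → D
  rev_rev : ∀ d, rev (rev d) = d
  src_ne_src_rev : ∀ d, src d ≠ src (rev d)
  ext_src : ∀ {d e}, src d = src e → src (rev d) = src (rev e) → d = e

namespace DartGraph

variable {D : Type*} {V : Type u} (M : DartGraph D V)

/-- The simple graph presented by darts. -/
def graph : SimpleGraph V where
  Adj v w := ∃ d, M.src d = v ∧ M.src (M.rev d) = w
  symm := ⟨fun _ _ ⟨d, h, h'⟩ => ⟨M.rev d, h', by rw [M.rev_rev, h]⟩⟩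
  loopless := ⟨fun _ ⟨d, h, h'⟩ => M.src_ne_src_rev d (h.trans h'.symm)⟩

theorem adj_src_src_rev (d : D) : M.graph.Adj (M.src d) (M.src (M.rev d)) :=
  ⟨d, rfl, rfl⟩

/-- The presenting darts are the darts of the graph. -/
noncomputable def dartEquiv : D ≃ M.graph.Dart :=
  Equiv.ofBijective (fun d => ⟨(M.src d, M.src (M.rev d)), M.adj_src_src_rev d⟩)
    ⟨fun _ _ h => M.ext_src (congrArg (fun k : M.graph.Dart => k.fst) h)
      (congrArg (fun k : M.graph.Dart => k.snd) h),
    fun ⟨_, d, h, h'⟩ => ⟨d, SimpleGraph.Dart.ext _ _ (Prod.ext h h')⟩⟩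

@[simp]
theorem dartEquiv_fst (d : D) : (M.dartEquiv d).fst = M.src d := rfl

@[simp]
theorem dartEquiv_snd (d : D) : (M.dartEquiv d).snd = M.src (M.rev d) := rfl

theorem dartEquiv_rev (d : D) : M.dartEquiv (M.rev d) = (M.dartEquiv d).symm :=
  SimpleGraph.Dart.ext _ _ (Prod.ext rfl (congrArg M.src (M.rev_rev d)))

theorem dartEquiv_symm_symm (d : M.graph.Dart) :
    M.dartEquiv.symm d.symm = M.rev (M.dartEquiv.symm d) := by
  rw [Equiv.symm_apply_eq, dartEquiv_rev, Equiv.apply_symm_apply]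

theorem src_dartEquiv_symm (d : M.graph.Dart) : M.src (M.dartEquiv.symm d) = d.fst := by
  rw [← dartEquiv_fst, Equiv.apply_symm_apply]

/-- The reversal of darts as a permutation. -/
def revPerm : Equiv.Perm D := Function.Involutive.toPerm M.rev M.rev_rev

theorem card_eq_two_mul_card_edgeSet [Finite V] : Nat.card D = 2 * Nat.card M.graph.edgeSet := by
  classical
  have := Fintype.ofFinite V
  rw [Nat.card_congr M.dartEquiv, Nat.card_eq_fintype_card,
    SimpleGraph.dart_card_eq_twice_card_edges, SimpleGraph.edgeFinset_card,
    ← Nat.card_eq_fintype_card]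

end DartGraph

/-- A connected plane graph given by its darts, vertices and faces. The orbits of the rotation are
the sets of darts with a common start, and those of the facial walks are the sets of darts with a
common value of `face`. -/
structure PlaneMap (D : Type*) (V : Type u) (F : Type*) extends DartGraph D V where
  /-- the next dart around the start of a dart -/
  rot : Equiv.Perm D
  /-- the face whose facial walk contains a dart -/
  face : D → F
  src_surjective : Function.Surjective src
  face_surjective : Function.Surjective face
  sameCycle_rot_iff : ∀ {d e}, rot.SameCycle d e ↔ src d = src e
  sameCycle_face_iff : ∀ {d e},
    Equiv.Perm.SameCycle (toDartGraph.revPerm.trans rot) d e ↔ face d = face e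
  connected : toDartGraph.graph.Connected
  /-- Euler's formula, with `card D` being twice the number of edges -/
  euler : 2 * (Nat.card V + Nat.card F) = Nat.card D + 4

namespace PlaneMap

variable {D F : Type*} {V : Type u} (M : PlaneMap D V F)

theorem permCongr_facePerm :
    (SimpleGraph.Dart.symm_involutive (G := M.graph)).toPerm.trans (M.dartEquiv.permCongr M.rot) =
      M.dartEquiv.permCongr (M.revPerm.trans M.rot) := by
  ext1 d
  simp only [Equiv.trans_apply, Equiv.permCongr_apply, Function.Involutive.coe_toPerm,
    M.dartEquiv_symm_symm]
  rfl

/-- The orbits of the facial walks are the presented faces. -/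
noncomputable def faceEquiv : Quotient (Equiv.Perm.SameCycle.setoid
    ((SimpleGraph.Dart.symm_involutive (G := M.graph)).toPerm.trans
      (M.dartEquiv.permCongr M.rot))) ≃ F :=
  have hface {d e : M.graph.Dart} : Equiv.Perm.SameCycle
      ((SimpleGraph.Dart.symm_involutive (G := M.graph)).toPerm.trans
        (M.dartEquiv.permCongr M.rot)) d e ↔
      M.face (M.dartEquiv.symm d) = M.face (M.dartEquiv.symm e) := by
    rw [M.permCongr_facePerm, sameCycle_permCongr_iff, M.sameCycle_face_iff]
  Equiv.ofBijective (Quotient.lift (fun d => M.face (M.dartEquiv.symm d)) fun _ _ => hface.1)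
    ⟨by rintro ⟨d⟩ ⟨e⟩ h; exact Quotient.sound (hface.2 h),
      Quotient.lift_surjective _ _ (M.face_surjective.comp M.dartEquiv.symm.surjective)⟩

/-- The plane graph presented by its darts, vertices and faces. -/
noncomputable def planeGraph [Finite V] : PlaneGraph V where
  graph := M.graph
  rot := M.dartEquiv.permCongr M.rot
  rot_fst d := by
    rw [← M.src_dartEquiv_symm, ← M.src_dartEquiv_symm, ← M.sameCycle_rot_iff,
      ← sameCycle_permCongr_iff]
    exact (Equiv.Perm.SameCycle.refl _ _).apply_left
  rot_cyclic d e h := by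
    rwa [sameCycle_permCongr_iff, M.sameCycle_rot_iff, M.src_dartEquiv_symm, M.src_dartEquiv_symm]
  connected := M.connected
  euler := by
    have := M.euler
    rw [M.card_eq_two_mul_card_edgeSet] at this
    rw [Nat.card_congr M.faceEquiv]
    omega

variable [Finite V] {M}

theorem incident_iff {w : V} {f : M.planeGraph.Face} :
    PlaneGraph.Incident w f ↔ ∃ d, M.src d = w ∧ M.face d = M.faceEquiv f := by
  have hface (d : D) : M.faceEquiv (M.planeGraph.faceOf (M.dartEquiv d)) = M.face d :=
    congrArg M.face (M.dartEquiv.symm_apply_apply d)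
  constructor
  · rintro ⟨d, rfl, rfl⟩
    obtain ⟨d, rfl⟩ := M.dartEquiv.surjective d
    exact ⟨d, rfl, (hface d).symm⟩
  · rintro ⟨d, rfl, hf⟩
    exact ⟨M.dartEquiv d, rfl, M.faceEquiv.injective ((hface d).trans hf)⟩

end PlaneMap

/-- A subdivision of a plane map by a plane map, every dart being replaced by a nonempty list of
darts that begins at the dart `corner`. -/
structure PlaneMapSubdivision {D D' F F' : Type*} {V : Type u} {W : Type v} (M : PlaneMap D V F)
    (N : PlaneMap D' W F') where
  /-- the vertex that an old vertex becomes -/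
  branch : V ↪ W
  /-- the darts that replace a dart, in order -/
  strand : D → List D'
  /-- the first of the darts that replace a dart -/
  corner : D → D'
  head?_strand : ∀ d, (strand d).head? = some (corner d)
  isChain_strand : ∀ d, (strand d).IsChain fun a b => N.src (N.rev a) = N.src b
  strand_rev : ∀ d, strand (M.rev d) = ((strand d).map N.rev).reverse
  nodup_strand : ∀ d, ((strand d).map N.src).Nodup
  src_corner : ∀ d, N.src (corner d) = branch (M.src d)
  rot_corner : ∀ d, N.rot (corner d) = corner (M.rot d)
  src_eq_of_mem : ∀ {d a x}, a ∈ strand d → N.src a = branch x → x = M.src d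
  src_mem_range : ∀ {d e a b}, a ∈ strand d → b ∈ strand e → N.src a = N.src b →
    e ≠ d → e ≠ M.rev d → N.src a ∈ Set.range branch
  exists_mem_strand : ∀ a, ∃ d, a ∈ strand d

namespace PlaneMapSubdivision

variable {D D' F F' : Type*} {V : Type u} {W : Type v} {M : PlaneMap D V F} {N : PlaneMap D' W F'}
  (S : PlaneMapSubdivision M N)

theorem strand_ne_nil (d : D) : S.strand d ≠ [] :=
  fun h => nomatch (congrArg List.head? h).symm.trans (S.head?_strand d)

theorem head_strand (d : D) : (S.strand d).head (S.strand_ne_nil d) = S.corner d :=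
  List.head_eq_iff_head?_eq_some _ |>.2 (S.head?_strand d)

theorem getLast_strand (d : D) :
    (S.strand d).getLast (S.strand_ne_nil d) = N.rev (S.corner (M.rev d)) := by
  have h := S.head?_strand (M.rev d)
  rw [S.strand_rev, List.head?_reverse, List.getLast?_map,
    List.getLast?_eq_some_getLast (S.strand_ne_nil d), Option.map_some, Option.some_inj] at h
  rw [← h, N.rev_rev]

theorem exists_walk (d : M.graph.Dart) :
    ∃ p : N.graph.Walk (S.branch d.fst) (S.branch d.snd),
      p.darts = (S.strand (M.dartEquiv.symm d)).map N.dartEquiv := by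
  obtain ⟨d, rfl⟩ := M.dartEquiv.surjective d
  have hne : (S.strand d).map N.dartEquiv ≠ [] := List.map_eq_nil_iff.not.2 (S.strand_ne_nil d)
  have hchain : ((S.strand d).map N.dartEquiv).IsChain N.graph.DartAdj :=
    (List.isChain_map _).2 (S.isChain_strand d)
  refine ⟨(SimpleGraph.Walk.ofDarts _ hne hchain).copy ?_ ?_, ?_⟩
  · rw [List.head_map, S.head_strand, N.dartEquiv_fst, S.src_corner, M.dartEquiv_fst]
  · rw [List.getLast_map, S.getLast_strand, N.dartEquiv_snd, N.rev_rev, S.src_corner,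
      M.dartEquiv_snd]
  · rw [SimpleGraph.Walk.darts_copy, SimpleGraph.Walk.darts_ofDarts, Equiv.symm_apply_apply]

/-- The path that replaces a dart. -/
noncomputable def path (d : M.graph.Dart) : N.graph.Walk (S.branch d.fst) (S.branch d.snd) :=
  (S.exists_walk d).choose

theorem darts_path (d : D) : (S.path (M.dartEquiv d)).darts = (S.strand d).map N.dartEquiv := by
  rw [path, (S.exists_walk _).choose_spec, Equiv.symm_apply_apply]

theorem support_path (d : D) : (S.path (M.dartEquiv d)).support =
    (S.strand d).map N.src ++ [S.branch (M.src (M.rev d))] := by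
  rw [← SimpleGraph.Walk.map_fst_darts_append, S.darts_path, List.map_map]
  rfl

theorem exists_mem_strand_of_mem_support {d : D} {w : W}
    (h : w ∈ (S.path (M.dartEquiv d)).support) :
    (∃ a ∈ S.strand d, N.src a = w) ∨ w = S.branch (M.src (M.rev d)) := by
  rwa [support_path, List.mem_append, List.mem_map, List.mem_singleton] at h

theorem isPath_path (d : M.graph.Dart) : (S.path d).IsPath := by
  obtain ⟨d, rfl⟩ := M.dartEquiv.surjective d
  rw [SimpleGraph.Walk.isPath_def, S.support_path, List.nodup_append_comm]
  refine List.nodup_cons.2 ⟨fun h => ?_, S.nodup_strand d⟩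
  obtain ⟨a, ha, hsrc⟩ := List.mem_map.1 h
  exact M.src_ne_src_rev d (S.src_eq_of_mem ha hsrc).symm

theorem path_symm (d : M.graph.Dart) : S.path d.symm = (S.path d).reverse := by
  obtain ⟨d, rfl⟩ := M.dartEquiv.surjective d
  have hrev : N.dartEquiv ∘ N.rev = SimpleGraph.Dart.symm ∘ N.dartEquiv := funext N.dartEquiv_rev
  have hsymm : (S.path (M.dartEquiv d).symm).darts =
      ((S.strand d).map N.dartEquiv |>.map SimpleGraph.Dart.symm).reverse := by
    rw [← M.dartEquiv_rev, S.darts_path, S.strand_rev, List.map_reverse, List.map_map,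
      List.map_map, hrev]
  have hreverse := SimpleGraph.Walk.darts_reverse (S.path (M.dartEquiv d))
  rw [S.darts_path] at hreverse
  exact SimpleGraph.Walk.darts_injective (hsymm.trans hreverse.symm)

theorem firstDart_path (d : M.graph.Dart) (h : ¬ (S.path d).Nil) :
    (S.path d).firstDart h = N.dartEquiv (S.corner (M.dartEquiv.symm d)) := by
  obtain ⟨d, rfl⟩ := M.dartEquiv.surjective d
  rw [← SimpleGraph.Walk.head_darts_eq_firstDart (SimpleGraph.Walk.darts_eq_nil.not.2 h)]
  simp only [S.darts_path, List.head_map, S.head_strand, Equiv.symm_apply_apply]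

theorem permCongr_rot_firstDart_path (d : M.graph.Dart) (h : ¬ (S.path d).Nil)
    (h' : ¬ (S.path (M.dartEquiv.permCongr M.rot d)).Nil) :
    N.dartEquiv.permCongr N.rot ((S.path d).firstDart h) =
      (S.path (M.dartEquiv.permCongr M.rot d)).firstDart h' := by
  simp only [S.firstDart_path, Equiv.permCongr_apply, Equiv.symm_apply_apply, S.rot_corner]

theorem eq_of_branch_mem_path {d : M.graph.Dart} {x : V}
    (h : S.branch x ∈ (S.path d).support) : x = d.fst ∨ x = d.snd := by
  obtain ⟨d, rfl⟩ := M.dartEquiv.surjective d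
  rcases S.exists_mem_strand_of_mem_support h with ⟨a, ha, hsrc⟩ | h
  · exact Or.inl (S.src_eq_of_mem ha hsrc)
  · exact Or.inr (S.branch.injective h)

theorem mem_range_branch_of_mem_path {d e : M.graph.Dart} {w : W} (hd : w ∈ (S.path d).support)
    (he : w ∈ (S.path e).support) (hde : d.edge ≠ e.edge) : w ∈ Set.range S.branch := by
  obtain ⟨d, rfl⟩ := M.dartEquiv.surjective d
  obtain ⟨e, rfl⟩ := M.dartEquiv.surjective e
  rcases S.exists_mem_strand_of_mem_support hd with ⟨a, ha, rfl⟩ | rfl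
  · rcases S.exists_mem_strand_of_mem_support he with ⟨b, hb, hsrc⟩ | hsrc
    · refine S.src_mem_range ha hb hsrc.symm ?_ ?_
      · rintro rfl
        exact hde rfl
      · rintro rfl
        rw [M.dartEquiv_rev, SimpleGraph.Dart.edge_symm] at hde
        exact hde rfl
    · exact ⟨_, hsrc.symm⟩
  · exact ⟨_, rfl⟩

theorem exists_mem_support_path (w : W) : ∃ d, w ∈ (S.path d).support := by
  obtain ⟨a, rfl⟩ := N.src_surjective w
  obtain ⟨d, hd⟩ := S.exists_mem_strand a
  refine ⟨M.dartEquiv d, ?_⟩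
  rw [S.support_path]
  exact List.mem_append_left _ (List.mem_map_of_mem hd)

theorem exists_mem_edges_path {e : Sym2 W} (he : e ∈ N.graph.edgeSet) :
    ∃ d, e ∈ (S.path d).edges := by
  induction e with | _ v w
  obtain ⟨a, rfl, rfl⟩ := he
  obtain ⟨d, hd⟩ := S.exists_mem_strand a
  refine ⟨M.dartEquiv d, ?_⟩
  rw [SimpleGraph.Walk.edges, S.darts_path]
  exact List.mem_map_of_mem (List.mem_map_of_mem hd)

variable [Finite V] [Finite W]

/-- The presentation of the plane graph of `N` as a subdivision of the plane graph of `M`. -/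
noncomputable def planeSubdivision : PlaneSubdivision M.planeGraph N.planeGraph where
  branch := S.branch
  path := S.path
  path_isPath := S.isPath_path
  path_symm := S.path_symm
  branch_mem_path _ _ := S.eq_of_branch_mem_path
  path_disjoint _ _ _ := S.mem_range_branch_of_mem_path
  vertex_covered w := Or.inr (S.exists_mem_support_path w)
  edge_covered _ := S.exists_mem_edges_path
  rot_firstDart := S.permCongr_rot_firstDart_path

end PlaneMapSubdivision

/-! ### Wheels with three subdivided spokes -/

/-- The vertices of a wheel with three spokes that are subdivided `t` times: the hub `none`, and the
vertices of each spoke, numbered outwards from `0`, of which the vertex `t` lies on the rim. -/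
abbrev WheelVertex (t : ℕ) : Type := Option (ZMod 3 × Fin (t + 1))

/-- The darts of a wheel with three subdivided spokes. The darts `out i j` and `inn i j` join the
vertex `j` of the spoke `i` to its predecessor, and `ccw i` and `cw i` are on the rim between the
spokes `i` and `i + 1`. -/
inductive WheelDart (t : ℕ) : Type
  | out (i : ZMod 3) (j : Fin (t + 1))
  | inn (i : ZMod 3) (j : Fin (t + 1))
  | ccw (i : ZMod 3)
  | cw (i : ZMod 3)

theorem zmod_three_eq_or (i i' : ZMod 3) : i' = i ∨ i' = i + 1 ∨ i' = i + 1 + 1 := by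
  revert i i'
  decide

theorem zmod_three_add_one_add_one_add_one (i : ZMod 3) : i + 1 + 1 + 1 = i := by
  revert i
  decide

namespace WheelDart

variable {t : ℕ}

/-- The predecessor of the vertex `j` of the spoke `i`, on the way from the hub. -/
def pred (i : ZMod 3) (j : Fin (t + 1)) : WheelVertex t :=
  Fin.cases none (fun k => some (i, k.castSucc)) j

@[simp]
theorem pred_zero (i : ZMod 3) : pred i (0 : Fin (t + 1)) = none := rfl

@[simp]
theorem pred_succ (i : ZMod 3) (k : Fin t) : pred i k.succ = some (i, k.castSucc) := rfl

theorem pred_eq_some_iff {i i' : ZMod 3} {j k : Fin (t + 1)} :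
    pred i j = some (i', k) ↔ i = i' ∧ (k : ℕ) + 1 = j := by
  cases j using Fin.cases with
  | zero => simp
  | succ j => simp [Fin.ext_iff, eq_comm]

theorem pred_injective (i : ZMod 3) :
    Function.Injective (pred i : Fin (t + 1) → WheelVertex t) := by
  intro j j' h
  cases j using Fin.cases <;> cases j' using Fin.cases <;> simp_all

theorem pred_ne_some (i i' : ZMod 3) (j : Fin (t + 1)) : pred i j ≠ some (i', j) := by
  rw [Ne, pred_eq_some_iff]
  omega

theorem pred_ne_last (i i' : ZMod 3) (j : Fin (t + 1)) : pred i j ≠ some (i', Fin.last t) := by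
  rw [Ne, pred_eq_some_iff, Fin.val_last]
  omega

/-- The vertex from which a dart starts. -/
def src : WheelDart t → WheelVertex t
  | out i j => pred i j
  | inn i j => some (i, j)
  | ccw i => some (i, Fin.last t)
  | cw i => some (i + 1, Fin.last t)

/-- The reversed dart. -/
def rev : WheelDart t → WheelDart t
  | out i j => inn i j
  | inn i j => out i j
  | ccw i => cw i
  | cw i => ccw i

theorem src_ne_src_rev (d : WheelDart t) : d.src ≠ d.rev.src := by
  cases d with
  | out i j => exact pred_ne_some i i j
  | inn i j => exact (pred_ne_some i i j).symm
  | ccw i => simp [src, rev]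
  | cw i => simp [src, rev]

theorem ext_src {d e : WheelDart t} (h : d.src = e.src) (h' : d.rev.src = e.rev.src) : d = e := by
  have hspoke {i i' : ZMod 3} {j j' : Fin (t + 1)} (h : pred i j = some (i', j')) :
      pred i' j' ≠ some (i, j) := by
    rw [pred_eq_some_iff] at h
    rw [Ne, pred_eq_some_iff]
    omega
  cases d <;> cases e <;> grind [src, rev, pred_ne_last, pred_ne_some]

/-- The next dart, counterclockwise, around the vertex from which a dart starts. -/
def rot : Equiv.Perm (WheelDart t) where
  toFun
    | out i j => Fin.cases (out (i + 1) 0) (fun k => inn i k.castSucc) j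
    | inn i j => Fin.lastCases (cw (i - 1)) (fun k => out i k.succ) j
    | ccw i => inn i (Fin.last t)
    | cw i => ccw (i + 1)
  invFun
    | out i j => Fin.cases (out (i - 1) 0) (fun k => inn i k.castSucc) j
    | inn i j => Fin.lastCases (ccw i) (fun k => out i k.succ) j
    | ccw i => cw (i - 1)
    | cw i => inn (i + 1) (Fin.last t)
  left_inv d := by
    cases d with
    | out i j => cases j using Fin.cases <;> simp
    | inn i j => cases j using Fin.lastCases <;> simp
    | ccw i => simp
    | cw i => simp
  right_inv d := by
    cases d with
    | out i j => cases j using Fin.cases <;> simp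
    | inn i j => cases j using Fin.lastCases <;> simp
    | ccw i => simp
    | cw i => simp

theorem rot_out_zero (i : ZMod 3) : rot (out i 0 : WheelDart t) = out (i + 1) 0 := rfl

theorem rot_out_succ (i : ZMod 3) (k : Fin t) : rot (out i k.succ) = inn i k.castSucc := rfl

theorem rot_inn_last (i : ZMod 3) : rot (inn i (Fin.last t)) = cw (i - 1) := by
  simp [rot]

theorem rot_inn_castSucc (i : ZMod 3) (k : Fin t) : rot (inn i k.castSucc) = out i k.succ := by
  simp [rot]

theorem rot_ccw (i : ZMod 3) : rot (ccw i : WheelDart t) = inn i (Fin.last t) := rfl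

theorem rot_cw (i : ZMod 3) : rot (cw i : WheelDart t) = ccw (i + 1) := rfl

theorem src_rot (d : WheelDart t) : (rot d).src = d.src := by
  cases d with
  | out i j => cases j using Fin.cases <;> rfl
  | inn i j => cases j using Fin.lastCases <;> simp [rot_inn_last, rot_inn_castSucc, src]
  | ccw i => rfl
  | cw i => rfl

/-- The face on the side of a dart: the face between the spokes `i` and `i + 1`, or the outer face
`none`. -/
def face : WheelDart t → Option (ZMod 3)
  | out i _ => some (i - 1)
  | inn i _ => some i
  | ccw _ => none
  | cw i => some i

theorem face_rot_rev (d : WheelDart t) : (rot d.rev).face = d.face := by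
  cases d with
  | out i j => cases j using Fin.lastCases <;> simp [rev, rot_inn_last, rot_inn_castSucc, face]
  | inn i j => cases j using Fin.cases <;> simp [rev, rot_out_zero, rot_out_succ, face]
  | ccw i => rfl
  | cw i => rfl

theorem sameCycle_of_apply_eq_add_one {p : Equiv.Perm (WheelDart t)} {f : ZMod 3 → WheelDart t}
    (h : ∀ i, p (f i) = f (i + 1)) (i i' : ZMod 3) : p.SameCycle (f i) (f i') := by
  have hstep (i : ZMod 3) : p.SameCycle (f i) (f (i + 1)) :=
    h i ▸ (Equiv.Perm.SameCycle.refl p _).apply_right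
  rcases zmod_three_eq_or i i' with rfl | rfl | rfl
  · exact Equiv.Perm.SameCycle.refl _ _
  · exact hstep i
  · exact (hstep i).trans (hstep _)

/-- A dart that starts from a given vertex. -/
def ofSrc : WheelVertex t → WheelDart t
  | none => out 0 0
  | some (i, j) => inn i j

theorem src_ofSrc (v : WheelVertex t) : (ofSrc v).src = v := by
  cases v <;> rfl

theorem sameCycle_rot_ofSrc (d : WheelDart t) : rot.SameCycle d (ofSrc d.src) := by
  have hrot (d : WheelDart t) : rot.SameCycle d (rot d) :=
    (Equiv.Perm.SameCycle.refl rot d).apply_right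
  cases d with
  | out i j =>
    cases j using Fin.cases with
    | zero => exact sameCycle_of_apply_eq_add_one (f := fun i => out i 0) rot_out_zero i 0
    | succ k => exact hrot _
  | inn i j => exact Equiv.Perm.SameCycle.refl _ _
  | ccw i => exact hrot _
  | cw i => exact (hrot _).trans (hrot _)

/-- A dart of a given face. -/
def ofFace : Option (ZMod 3) → WheelDart t
  | none => ccw 0
  | some i => inn i 0

theorem face_ofFace (f : Option (ZMod 3)) : (ofFace f : WheelDart t).face = f := by
  cases f <;> rfl

/-- The wheel with three subdivided spokes as a graph. -/
def dartGraph (t : ℕ) : DartGraph (WheelDart t) (WheelVertex t) where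
  src := src
  rev := rev
  rev_rev d := by cases d <;> rfl
  src_ne_src_rev := src_ne_src_rev
  ext_src := ext_src

theorem sameCycle_ofFace (d : WheelDart t) :
    Equiv.Perm.SameCycle ((dartGraph t).revPerm.trans rot) d (ofFace d.face) := by
  set p : Equiv.Perm (WheelDart t) := (dartGraph t).revPerm.trans rot
  have hp {d e : WheelDart t} (h : rot d.rev = e) : p.SameCycle d e :=
    h ▸ (Equiv.Perm.SameCycle.refl p d).apply_right
  have hinn (i : ZMod 3) (j : Fin (t + 1)) : p.SameCycle (inn i j) (inn i 0) := by
    induction j using Fin.induction with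
    | zero => exact Equiv.Perm.SameCycle.refl _ _
    | succ k ih => exact (hp (d := inn i k.succ) (rot_out_succ i k)).trans ih
  have hcw (i : ZMod 3) : p.SameCycle (cw i) (inn i 0) := (hp (rot_ccw i)).trans (hinn i _)
  have hout (i : ZMod 3) (j : Fin (t + 1)) : p.SameCycle (out i j) (inn (i - 1) 0) := by
    induction j using Fin.reverseInduction with
    | last => exact (hp (rot_inn_last i)).trans (hcw _)
    | cast k ih => exact (hp (d := out i k.castSucc) (rot_inn_castSucc i k)).trans ih
  cases d with
  | out i j => exact hout i j
  | inn i j => exact hinn i j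
  | ccw i => exact sameCycle_of_apply_eq_add_one (p := p) (f := ccw) rot_cw i 0
  | cw i => exact hcw i

theorem connected_graph (t : ℕ) : (dartGraph t).graph.Connected := by
  have hnone (v : WheelVertex t) : (dartGraph t).graph.Reachable none v := by
    rcases v with _ | ⟨i, j⟩
    · exact SimpleGraph.Reachable.refl _
    · have hadj (j : Fin (t + 1)) : (dartGraph t).graph.Adj (pred i j) (some (i, j)) :=
        (dartGraph t).adj_src_src_rev (out i j)
      induction j using Fin.induction with
      | zero => exact (hadj 0).reachable
      | succ k ih => exact ih.trans (hadj k.succ).reachable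
  exact ⟨fun v w => (hnone v).symm.trans (hnone w)⟩

/-- The darts are the edges, of the spokes and of the rim, with a direction. -/
def equivSum : WheelDart t ≃ ((ZMod 3 × Fin (t + 1)) ⊕ ZMod 3) × Bool where
  toFun
    | out i j => (Sum.inl (i, j), true)
    | inn i j => (Sum.inl (i, j), false)
    | ccw i => (Sum.inr i, true)
    | cw i => (Sum.inr i, false)
  invFun
    | (Sum.inl (i, j), true) => out i j
    | (Sum.inl (i, j), false) => inn i j
    | (Sum.inr i, true) => ccw i
    | (Sum.inr i, false) => cw i
  left_inv d := by cases d <;> rfl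
  right_inv := by rintro ⟨⟨i, j⟩ | i, _ | _⟩ <;> rfl

theorem card_eq (t : ℕ) : Nat.card (WheelDart t) = 2 * (3 * t + 6) := by
  rw [Nat.card_congr equivSum, Nat.card_prod, Nat.card_sum, Nat.card_prod, Nat.card_zmod,
    Nat.card_eq_fintype_card, Nat.card_eq_fintype_card, Fintype.card_fin, Fintype.card_bool]
  ring

end WheelDart

theorem card_wheelVertex (t : ℕ) : Nat.card (WheelVertex t) = 3 * t + 4 := by
  rw [Finite.card_option, Nat.card_prod, Nat.card_zmod, Nat.card_eq_fintype_card, Fintype.card_fin]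
  ring

/-- The wheel with three spokes that are subdivided `t` times, in the plane. -/
def wheelMap (t : ℕ) : PlaneMap (WheelDart t) (WheelVertex t) (Option (ZMod 3)) where
  toDartGraph := WheelDart.dartGraph t
  rot := WheelDart.rot
  face := WheelDart.face
  src_surjective v := ⟨WheelDart.ofSrc v, WheelDart.src_ofSrc v⟩
  face_surjective f := ⟨WheelDart.ofFace f, WheelDart.face_ofFace f⟩
  sameCycle_rot_iff := sameCycle_iff_of_section WheelDart.src_rot WheelDart.sameCycle_rot_ofSrc
  sameCycle_face_iff :=
    sameCycle_iff_of_section WheelDart.face_rot_rev WheelDart.sameCycle_ofFace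
  connected := WheelDart.connected_graph t
  euler := by
    rw [card_wheelVertex, WheelDart.card_eq, Finite.card_option, Nat.card_zmod]
    ring

namespace WheelDart

variable {t : ℕ}

/-- The dart of the wheel whose subdivision contains a given dart. -/
def base : WheelDart t → WheelDart 0
  | out i _ => out i 0
  | inn i _ => inn i 0
  | ccw i => ccw i
  | cw i => cw i

/-- The darts that replace a dart of the wheel when its spokes are subdivided. -/
def strand (t : ℕ) : WheelDart 0 → List (WheelDart t)
  | out i _ => List.ofFn (out i)
  | inn i _ => (List.ofFn (inn i)).reverse
  | ccw i => [ccw i]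
  | cw i => [cw i]

/-- The first of the darts that replace a dart of the wheel. -/
def corner (t : ℕ) : WheelDart 0 → WheelDart t
  | out i _ => out i 0
  | inn i _ => inn i (Fin.last t)
  | ccw i => ccw i
  | cw i => cw i

theorem mem_strand_iff {a : WheelDart t} {d : WheelDart 0} : a ∈ strand t d ↔ a.base = d := by
  cases d with
  | out i j =>
    rw [Subsingleton.elim (α := Fin 1) j 0]
    cases a <;> simp [strand, base, List.mem_ofFn, -List.ofFn_succ, eq_comm]
  | inn i j =>
    rw [Subsingleton.elim (α := Fin 1) j 0]
    cases a <;> simp [strand, base, List.mem_ofFn, -List.ofFn_succ, eq_comm]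
  | ccw i => cases a <;> simp [strand, base]
  | cw i => cases a <;> simp [strand, base]

theorem head?_strand (d : WheelDart 0) : (strand t d).head? = some (corner t d) := by
  cases d with
  | out i j => simp only [strand, corner, List.ofFn_succ, List.head?_cons]
  | inn i j => simp only [strand, corner, List.head?_reverse, List.ofFn_succ_last,
      List.getLast?_concat]
  | ccw i => rfl
  | cw i => rfl

theorem isChain_strand (d : WheelDart 0) :
    (strand t d).IsChain fun a b => a.rev.src = b.src := by
  cases d with
  | out i j => exact List.isChain_ofFn.2 fun _ _ => rfl
  | inn i j => exact List.isChain_reverse.2 (List.isChain_ofFn.2 fun _ _ => rfl)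
  | ccw i => exact List.isChain_singleton _
  | cw i => exact List.isChain_singleton _

theorem strand_rev (d : WheelDart 0) : strand t d.rev = ((strand t d).map rev).reverse := by
  cases d with
  | out i j => rw [strand, List.map_ofFn]; rfl
  | inn i j => rw [strand, List.map_reverse, List.reverse_reverse, List.map_ofFn]; rfl
  | ccw i => rfl
  | cw i => rfl

theorem nodup_strand (d : WheelDart 0) : ((strand t d).map src).Nodup := by
  cases d with
  | out i j =>
    rw [strand, List.map_ofFn]
    exact List.nodup_ofFn.2 (pred_injective i)
  | inn i j =>
    rw [strand, List.map_reverse, List.nodup_reverse, List.map_ofFn]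
    exact List.nodup_ofFn.2 fun j j' h => (Prod.ext_iff.1 (Option.some.inj h)).2
  | ccw i => exact List.nodup_singleton _
  | cw i => exact List.nodup_singleton _

theorem rot_corner (d : WheelDart 0) : rot (corner t d) = corner t (rot d) := by
  cases d with
  | out i j => rw [Subsingleton.elim (α := Fin 1) j 0]; rfl
  | inn i j =>
    rw [Subsingleton.elim (α := Fin 1) j (Fin.last 0), corner, rot_inn_last, rot_inn_last]
    rfl
  | ccw i => rfl
  | cw i => rfl

/-- The vertices of the wheel, as vertices of the subdivided wheel. -/
def branch (t : ℕ) : WheelVertex 0 ↪ WheelVertex t :=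
  (Function.Embedding.prodMap (Function.Embedding.refl _)
    ⟨fun _ => Fin.last t, Function.injective_of_subsingleton (α := Fin 1) _⟩).optionMap

theorem branch_none : branch t none = none := rfl

theorem branch_some (i : ZMod 3) (j : Fin 1) : branch t (some (i, j)) = some (i, Fin.last t) := rfl

theorem src_corner (d : WheelDart 0) : (corner t d).src = branch t d.src := by
  cases d with
  | out i j => rw [Subsingleton.elim (α := Fin 1) j 0]; rfl
  | inn i j => rfl
  | ccw i => rfl
  | cw i => rfl

theorem eq_src_base_of_src_eq_branch {a : WheelDart t} {x : WheelVertex 0}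
    (h : a.src = branch t x) : x = a.base.src := by
  rcases x with _ | ⟨i, j⟩
  · cases a with
    | out i j => rfl
    | inn i j => exact nomatch h
    | ccw i => exact nomatch h
    | cw i => exact nomatch h
  · have hspoke {i' : ZMod 3} {j' : Fin (t + 1)} (h : some (i', j') = branch t (some (i, j))) :
        i = i' :=
      (congrArg Prod.fst (Option.some.inj h)).symm
    rw [Subsingleton.elim (α := Fin 1) j 0]
    cases a with
    | out i' j' => exact absurd h (pred_ne_last i' i j')
    | inn i' j' => exact congrArg (fun i => some (i, 0)) (hspoke h)
    | ccw i' => exact congrArg (fun i => some (i, 0)) (hspoke h)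
    | cw i' => exact congrArg (fun i => some (i, 0)) (hspoke h)

theorem mem_range_branch_or_exists_eq_castSucc (v : WheelVertex t) :
    v ∈ Set.range (branch t) ∨ ∃ i, ∃ k : Fin t, v = some (i, k.castSucc) := by
  rcases v with _ | ⟨i, j⟩
  · exact Or.inl ⟨none, branch_none⟩
  · cases j using Fin.lastCases with
    | last => exact Or.inl ⟨some (i, 0), branch_some i 0⟩
    | cast k => exact Or.inr ⟨i, k, rfl⟩

theorem base_eq_of_src_eq_castSucc {a : WheelDart t} {i : ZMod 3} {k : Fin t}
    (h : a.src = some (i, k.castSucc)) : a.base = out i 0 ∨ a.base = inn i 0 := by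
  cases a with
  | out i' j => exact Or.inl (by rw [base, (pred_eq_some_iff.1 h).1])
  | inn i' j =>
    exact Or.inr (congrArg (fun i => inn i 0) (congrArg Prod.fst (Option.some.inj h)))
  | ccw i' => exact absurd (Prod.ext_iff.1 (Option.some.inj h)).2 (Fin.castSucc_lt_last k).ne'
  | cw i' => exact absurd (Prod.ext_iff.1 (Option.some.inj h)).2 (Fin.castSucc_lt_last k).ne'

theorem src_mem_range_branch {a b : WheelDart t} (h : a.src = b.src) (hne : b.base ≠ a.base)
    (hne' : b.base ≠ a.base.rev) : a.src ∈ Set.range (branch t) := by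
  refine (mem_range_branch_or_exists_eq_castSucc a.src).resolve_right ?_
  rintro ⟨i, k, ha⟩
  rcases base_eq_of_src_eq_castSucc ha with ha' | ha' <;>
    rcases base_eq_of_src_eq_castSucc (h ▸ ha) with hb' | hb' <;>
    simp [ha', hb', rev] at hne hne'

end WheelDart

/-- The wheel with three subdivided spokes as a subdivision of the wheel. -/
def wheelSubdivision (t : ℕ) : PlaneMapSubdivision (wheelMap 0) (wheelMap t) where
  branch := WheelDart.branch t
  strand := WheelDart.strand t
  corner := WheelDart.corner t
  head?_strand := WheelDart.head?_strand
  isChain_strand := WheelDart.isChain_strand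
  strand_rev := WheelDart.strand_rev
  nodup_strand := WheelDart.nodup_strand
  src_corner := WheelDart.src_corner
  rot_corner := WheelDart.rot_corner
  src_eq_of_mem ha h := WheelDart.mem_strand_iff.1 ha ▸ WheelDart.eq_src_base_of_src_eq_branch h
  src_mem_range ha hb h := by
    rw [← WheelDart.mem_strand_iff.1 ha, ← WheelDart.mem_strand_iff.1 hb]
    exact WheelDart.src_mem_range_branch h
  exists_mem_strand a := ⟨a.base, WheelDart.mem_strand_iff.2 rfl⟩

theorem apply_eq_of_mem_support {V α : Type*} {G : SimpleGraph V} {φ : V → α} {x y : V}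
    {p : G.Walk x y} (hφ : ∀ d ∈ p.darts, φ d.snd = φ d.fst) {w : V} (hw : w ∈ p.support) :
    φ w = φ x := by
  induction p with
  | nil => rw [List.mem_singleton.1 hw]
  | cons h p ih =>
    rcases List.mem_cons.1 hw with rfl | hw
    · rfl
    · exact (ih (fun d hd => hφ d (List.mem_cons_of_mem _ hd)) hw).trans
        (hφ _ List.mem_cons_self)

namespace WheelDart

variable {t : ℕ}

theorem setOf_incident_of_faceEquiv_eq_none {f : (wheelMap t).planeGraph.Face}
    (hf : (wheelMap t).faceEquiv f = none) :
    {w | PlaneGraph.Incident w f} = Set.range fun i => some (i, Fin.last t) := by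
  ext w
  rw [Set.mem_ofPred_eq, PlaneMap.incident_iff, hf]
  constructor
  · rintro ⟨d, rfl, hd⟩
    cases d with
    | out i j => exact nomatch hd
    | inn i j => exact nomatch hd
    | ccw i => exact ⟨i, rfl⟩
    | cw i => exact nomatch hd
  · rintro ⟨i, rfl⟩
    exact ⟨ccw i, rfl, rfl⟩

theorem setOf_incident_of_faceEquiv_eq_some {f : (wheelMap t).planeGraph.Face} {i : ZMod 3}
    (hf : (wheelMap t).faceEquiv f = some i) :
    {w | PlaneGraph.Incident w f} = insert none (some '' ({i, i + 1} ×ˢ Set.univ)) := by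
  ext w
  rw [Set.mem_ofPred_eq, PlaneMap.incident_iff, hf]
  constructor
  · rintro ⟨d, rfl, hd⟩
    cases d with
    | out i' j =>
      obtain rfl : i' = i + 1 := sub_eq_iff_eq_add.1 (Option.some.inj hd)
      cases j using Fin.cases with
      | zero => exact Or.inl rfl
      | succ k => exact Or.inr ⟨(i + 1, k.castSucc), ⟨Or.inr rfl, trivial⟩, rfl⟩
    | inn i' j =>
      obtain rfl : i' = i := Option.some.inj hd
      exact Or.inr ⟨(i', j), ⟨Or.inl rfl, trivial⟩, rfl⟩
    | ccw i' => exact nomatch hd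
    | cw i' =>
      obtain rfl : i' = i := Option.some.inj hd
      exact Or.inr ⟨(i' + 1, Fin.last t), ⟨Or.inr rfl, trivial⟩, rfl⟩
  · have hface (j : Fin (t + 1)) : face (out (i + 1) j) = some i :=
      congrArg some (add_sub_cancel_right i 1)
    rintro (rfl | ⟨⟨i', j⟩, ⟨hi, -⟩, rfl⟩)
    · exact ⟨out (i + 1) 0, rfl, hface 0⟩
    obtain rfl | rfl : i' = i ∨ i' = i + 1 := hi
    · exact ⟨inn i' j, rfl, rfl⟩
    · cases j using Fin.lastCases with
      | last => exact ⟨cw i, rfl, rfl⟩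
      | cast k => exact ⟨out (i + 1) k.succ, rfl, hface k.succ⟩

theorem faceDegree_eq (f : (wheelMap t).planeGraph.Face) :
    (wheelMap t).planeGraph.faceDegree f =
      if (wheelMap t).faceEquiv f = none then 3 else 2 * t + 3 := by
  rw [PlaneGraph.faceDegree]
  rcases hf : (wheelMap t).faceEquiv f with _ | i
  · rw [setOf_incident_of_faceEquiv_eq_none hf, Set.ncard_range_of_injective, Nat.card_zmod,
      if_pos rfl]
    exact fun _ _ h => congrArg Prod.fst (Option.some.inj h)
  · rw [setOf_incident_of_faceEquiv_eq_some hf, Set.ncard_insert_of_notMem (by simp),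
      Set.ncard_image_of_injective _ (Option.some_injective _), Set.ncard_prod,
      Set.ncard_pair (by simp), Set.ncard_univ, Nat.card_fin, if_neg (Option.some_ne_none i)]
    ring

theorem exists_incident_and_incident (v w : WheelVertex t) :
    ∃ f : (wheelMap t).planeGraph.Face, PlaneGraph.Incident v f ∧ PlaneGraph.Incident w f := by
  suffices ∃ i : ZMod 3, {v, w} ⊆ insert none (some '' ({i, i + 1} ×ˢ Set.univ)) by
    obtain ⟨i, hi⟩ := this
    rw [← setOf_incident_of_faceEquiv_eq_some ((wheelMap t).faceEquiv.apply_symm_apply _)] at hi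
    exact ⟨_, hi (Set.mem_insert v _), hi (Set.mem_insert_of_mem v rfl)⟩
  rcases v with _ | ⟨i, j⟩ <;> rcases w with _ | ⟨i', j'⟩
  · exact ⟨0, by simp⟩
  · exact ⟨i', by simp⟩
  · exact ⟨i, by simp [Set.pair_subset_iff]⟩
  · rcases zmod_three_eq_or i i' with rfl | rfl | rfl
    · exact ⟨i', by simp [Set.pair_subset_iff]⟩
    · exact ⟨i, by simp [Set.pair_subset_iff]⟩
    · exact ⟨i + 1 + 1, by simp [Set.pair_subset_iff, zmod_three_add_one_add_one_add_one]⟩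

theorem cyclicChromaticNumber_eq (t : ℕ) :
    (wheelMap t).planeGraph.cyclicChromaticNumber = 3 * t + 4 := by
  rw [PlaneGraph.cyclicChromaticNumber_eq_card exists_incident_and_incident, card_wheelVertex]

theorem two_lt_ncard_neighborSet_none : 2 < ((dartGraph t).graph.neighborSet none).ncard := by
  have hadj (i : ZMod 3) : (dartGraph t).graph.Adj none (some (i, 0)) :=
    (dartGraph t).adj_src_src_rev (out i 0)
  refine (Set.two_lt_ncard_iff).2 ⟨_, _, _, hadj 0, hadj 1, hadj 2, ?_⟩
  simp only [ne_eq, Option.some.injEq, Prod.mk.injEq, and_true]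
  decide

theorem two_lt_ncard_neighborSet_last (i : ZMod 3) :
    2 < ((dartGraph t).graph.neighborSet (some (i, Fin.last t))).ncard := by
  have hccw : (dartGraph t).graph.Adj (some (i, Fin.last t)) (some (i + 1, Fin.last t)) :=
    (dartGraph t).adj_src_src_rev (ccw i)
  have hcw : (dartGraph t).graph.Adj (some (i + 1 + 1 + 1, Fin.last t))
      (some (i + 1 + 1, Fin.last t)) :=
    (dartGraph t).adj_src_src_rev (cw (i + 1 + 1))
  rw [zmod_three_add_one_add_one_add_one] at hcw
  have hinn : (dartGraph t).graph.Adj (some (i, Fin.last t)) (pred i (Fin.last t)) :=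
    (dartGraph t).adj_src_src_rev (inn i (Fin.last t))
  refine (Set.two_lt_ncard_iff).2 ⟨_, _, _, hinn, hccw, hcw, ?_⟩
  exact ⟨pred_ne_last _ _ _, pred_ne_last _ _ _, by simp⟩

theorem exists_eq_castSucc_of_ncard_neighborSet_eq_two {w : WheelVertex t}
    (h : ((dartGraph t).graph.neighborSet w).ncard = 2) :
    ∃ i, ∃ k : Fin t, w = some (i, k.castSucc) := by
  refine (mem_range_branch_or_exists_eq_castSucc w).resolve_left ?_
  rintro ⟨_ | ⟨i, j⟩, rfl⟩
  · exact two_lt_ncard_neighborSet_none.ne' h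
  · exact (two_lt_ncard_neighborSet_last i).ne' h

theorem fst_eq_fst_of_adj {i i' : ZMod 3} {k k' : Fin t}
    (h : (dartGraph t).graph.Adj (some (i, k.castSucc)) (some (i', k'.castSucc))) : i' = i := by
  obtain ⟨d, h, h'⟩ := h
  have hlast {i'} : some (i', Fin.last t) ≠ some (i, k.castSucc) :=
    fun h => (Fin.castSucc_lt_last k).ne' (congrArg Prod.snd (Option.some.inj h))
  cases d with
  | out l j => exact (congrArg Prod.fst (Option.some.inj h')).symm.trans (pred_eq_some_iff.1 h).1
  | inn l j => exact (pred_eq_some_iff.1 h').1.symm.trans (congrArg Prod.fst (Option.some.inj h))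
  | ccw l => exact absurd h hlast
  | cw l => exact absurd h hlast

theorem longestTwoPath_le (t : ℕ) : (wheelMap t).planeGraph.longestTwoPath ≤ t := by
  refine csSup_le' ?_
  rintro _ ⟨x, y, p, hp, h, rfl⟩
  replace h (w) (hw : w ∈ p.support) := exists_eq_castSucc_of_ncard_neighborSet_eq_two (h w hw)
  obtain ⟨i, k, rfl⟩ := h x p.start_mem_support
  have hspoke {w} (hw : w ∈ p.support) : w.map Prod.fst = some i :=
    apply_eq_of_mem_support (φ := Option.map Prod.fst) (fun d hd => by
      obtain ⟨i₁, k₁, h₁⟩ := h _ (p.dart_fst_mem_support_of_mem_darts hd)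
      obtain ⟨i₂, k₂, h₂⟩ := h _ (p.dart_snd_mem_support_of_mem_darts hd)
      have hadj := d.adj
      rw [h₁, h₂] at hadj
      rw [h₁, h₂, fst_eq_fst_of_adj hadj]
      rfl) hw
  classical
  calc p.support.length = p.support.toFinset.card :=
        (List.toFinset_card_of_nodup hp.support_nodup).symm
    _ ≤ (Finset.univ.image fun k : Fin t => some (i, k.castSucc)).card := by
      refine Finset.card_le_card fun w hw => ?_
      obtain ⟨i', k, rfl⟩ := h w (List.mem_toFinset.1 hw)
      obtain rfl : i' = i := Option.some.inj (hspoke (List.mem_toFinset.1 hw))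
      exact Finset.mem_image_of_mem _ (Finset.mem_univ k)
    _ ≤ t := Finset.card_image_le.trans_eq (Finset.card_fin t)

theorem isThreeConnected : (wheelMap 0).planeGraph.IsThreeConnected := by
  have hspoke (i : ZMod 3) (j : Fin 1) : (dartGraph 0).graph.Adj none (some (i, j)) :=
    Subsingleton.elim 0 j ▸ (dartGraph 0).adj_src_src_rev (out i 0)
  have hrim (i : ZMod 3) (j j' : Fin 1) :
      (dartGraph 0).graph.Adj (some (i, j)) (some (i + 1, j')) :=
    Subsingleton.elim 0 j ▸ Subsingleton.elim 0 j' ▸ (dartGraph 0).adj_src_src_rev (ccw i)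
  refine PlaneGraph.isThreeConnected_of_forall_adj (by rw [card_wheelVertex]; norm_num) ?_
  rintro (_ | ⟨i, j⟩) (_ | ⟨i', j'⟩) h
  · exact absurd rfl h
  · exact hspoke i' j'
  · exact (hspoke i j).symm
  · rcases zmod_three_eq_or i i' with rfl | rfl | rfl
    · exact absurd (Subsingleton.elim (α := Fin 1) j j' ▸ rfl) h
    · exact hrim i j j'
    · have := hrim (i + 1 + 1) j' j
      rw [zmod_three_add_one_add_one_add_one] at this
      exact this.symm

end WheelDart

theorem maxExcess_wheelSubdivision_le (t : ℕ) :
    (wheelSubdivision t).planeSubdivision.maxExcess ≤ 2 * t := by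
  have := (wheelMap t).planeGraph.nonempty_face
  refine ciSup_le fun f => ?_
  rw [WheelDart.faceDegree_eq, WheelDart.faceDegree_eq]
  split_ifs <;> omega

theorem theorem8_general :
    (∀ (V : Type u) (W : Type v) [Finite W] (R : PlaneGraph V) (G : PlaneGraph W)
      (S : PlaneSubdivision R G), R.graph.IsEdgeConnected 3 →
        (G.cyclicChromaticNumber : ℤ)
          ≤ S.maxExcess + G.longestTwoPath + R.cyclicChromaticNumber) ∧
    (∀ t : ℕ, ∃ (V W : Type) (_ : Finite V) (_ : Finite W) (R : PlaneGraph V) (G : PlaneGraph W)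
      (S : PlaneSubdivision R G), R.IsThreeConnected ∧ G.longestTwoPath = t ∧
        (G.cyclicChromaticNumber : ℤ)
          = S.maxExcess + G.longestTwoPath + R.cyclicChromaticNumber) := by
  refine ⟨fun V W _ R G S hR => S.cyclicChromaticNumber_le hR, fun t => ?_⟩
  have hR := WheelDart.isThreeConnected
  have hbound := (wheelSubdivision t).planeSubdivision.cyclicChromaticNumber_le hR.isEdgeConnected
  have hexcess := maxExcess_wheelSubdivision_le t
  have hpath := WheelDart.longestTwoPath_le t
  have hwheel := WheelDart.cyclicChromaticNumber_eq
  rw [hwheel, hwheel] at hbound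
  refine ⟨_, _, inferInstance, inferInstance, _, _, (wheelSubdivision t).planeSubdivision, hR, ?_⟩
  rw [hwheel, hwheel]
  omega

theorem theorem8 :
    (∀ (V : Type u) (W : Type v) [Finite V] [Finite W] (R : PlaneGraph V) (G : PlaneGraph W)
      (S : PlaneSubdivision R G), R.IsThreeConnected →
        (G.cyclicChromaticNumber : ℤ)
          ≤ S.maxExcess + G.longestTwoPath + R.cyclicChromaticNumber) ∧
    (∀ t : ℕ, ∃ (V W : Type) (_ : Finite V) (_ : Finite W) (R : PlaneGraph V) (G : PlaneGraph W)
      (S : PlaneSubdivision R G), R.IsThreeConnected ∧ G.longestTwoPath = t ∧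
        (G.cyclicChromaticNumber : ℤ)
          = S.maxExcess + G.longestTwoPath + R.cyclicChromaticNumber) :=
  ⟨fun V W _ _ R G S hR => theorem8_general.{u, v}.1 V W R G S hR.isEdgeConnected,
    theorem8_general.{u, v}.2⟩
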